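/- Let $G^{\alpha}=\langle X\mid R\rangle$, $|X|=n$, be a presentation of a non-trivial group $G$, and let $\mathcal G$ be its Cayley graph, with vertex set $G$ and, for every $g\in G$ and $x\in X$, one edge from $g$ to $gx$ (so a generator of order $2$ gives double edges). For $Y\subseteq X$ let $Gp(Y)$ be the subgroup of $G$ generated by $Y$, with the induced presentation on the generators $Y$. Suppose that the presentation is minimal, i.e. $Gp(X')\neq G$ for every proper subset $X'\subsetneq X$. For a finite subgraph $\mathcal G'$ let $\beta_0(\mathcal G')$ be its number of vertices and $\beta_2(\mathcal G')$ the sum, over its connected components, of the ranks of their fundamental groups. Put $$\Psi(G^{\alpha})=\sup_{\mathcal G'}\frac{\beta_2(\mathcal G')}{\beta_0(\mathcal G')-1},\qquad \hat\Psi(G^{\alpha})=1-n+\Psi(G^{\alpha}),$$ the supremum being over all finite subgraphs $\mathcal G'$ of $\mathcal G$ with more than one vertex (so that it is $-\infty$ for a presentation of the trivial group), and $$\Xi(G^{\alpha})=\sup_{(\mathcal G_i)}\ \limsup_{i\to\infty}\frac{\beta_2(\mathcal G_i)}{\beta_0(\mathcal G_i)},$$ the supremum being over all increasing sequences $\mathcal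 G_1\subseteq\mathcal G_2\subseteq\cdots$ of finite connected subgraphs of $\mathcal G$ whose union is $\mathcal G$. All suprema are taken in the extended reals. A group is amenable if there is an invariant mean on the space of all bounded complex-valued functions on it. Then $1-n\le\hat\Psi(G^{\alpha})\le 1$. Moreover: (i) If $G$ is finite, then $\hat\Psi(G^{\alpha})=\dfrac{n}{|G|-1}$, and $\hat\Psi(G^{\alpha})=1$ if and only if $|G|=2$. (ii) If $G$ is infinite, then $\hat\Psi(G^{\alpha})\le 0$; equality holds if and only if $G$ is amenable, or $n=2$ and at least one of the two generators has order $2$. Furthermore $\hat\Psi(G^{\alpha})=1-n$ if and only if $G$ is free of rank $n$. (iii) Let $m=\max\{|X''| : X''\subseteq X,\ |Gp(X'')|<\infty\}$, and let $Y\subseteq X$ satisfy $|Y|=m$ and $|Gp(Y)|=\min\{|Gp(X')| : X'\subseteq X,\ |X'|=m\}$. Then for $H=Gp(Y)$, with its induced presentation $H^{\alpha}$, $$\Psi(G^{\alpha})=\max\bigl(\Xi(G^{\alpha}),\Psi(H^{\alpha})\bigr),$$ and, if $H$ is non-trivial, $\Psi(H^{\alpha})=m-1+\dfrac{m}{|H|-1}$.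 -/

import Mathlib

universe u v

/-- A presentation of the group `G` with generating symbols `X`: relators `rels`, and an
assignment `gen` of elements of `G` to the symbols that generate `G`, such that the words equal
to `1` in `G` are exactly those in the normal closure of the relators. -/
structure GroupPresentation (X : Type u) (G : Type v) [Group G] where
  rels : Set (FreeGroup X)
  gen : X → G
  surjective_lift : Function.Surjective (FreeGroup.lift gen)
  ker_lift : (FreeGroup.lift gen).ker = Subgroup.normalClosure rels

/-- The rank (minimal number of generators) of a finitely generated group; `0` is a dummy value
for groups that are not finitely generated. -/
noncomputable def groupRank (A : Type*) [Group A] : ℕ :=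
  open Classical in if h : Group.FG A then @Group.rank A _ h else 0

open scoped ENNReal ComplexOrder in
/-- A group is amenable if the space of all bounded complex-valued functions on it carries an
invariant mean: a positive normalized linear functional that does not change when a function is
translated. -/
def IsAmenableGroup (G : Type*) [Group G] : Prop :=
  ∃ m : lp (fun _ : G => ℂ) ∞ →ₗ[ℂ] ℂ,
    m 1 = 1 ∧
    (∀ f, (∀ g, 0 ≤ f g) → 0 ≤ m f) ∧
    ∀ (a : G) (f f' : lp (fun _ : G => ℂ) ∞), (∀ g, f' g = f (a * g)) → m f' = m f

namespace GroupPresentation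

variable {X : Type u} {G : Type v} [Group G]

/-- `Gp(Y)`, the subgroup of `G` generated by the generators in `Y`. -/
def Gp (P : GroupPresentation X G) (Y : Set X) : Subgroup G :=
  Subgroup.closure (P.gen '' Y)

/-- No proper subset of the generating symbols generates `G`. -/
def IsMinimal (P : GroupPresentation X G) : Prop :=
  ∀ Y : Set X, Y ≠ Set.univ → P.Gp Y ≠ ⊤

/-- The generators `Y` as elements of `Gp(Y)`. -/
def inducedGen (P : GroupPresentation X G) (Y : Set X) (y : Y) : P.Gp Y :=
  ⟨P.gen y, Subgroup.subset_closure ⟨y, y.2, rfl⟩⟩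

theorem surjective_lift_inducedGen (P : GroupPresentation X G) (Y : Set X) :
    Function.Surjective (FreeGroup.lift (P.inducedGen Y)) := by
  have h : Set.range (P.inducedGen Y) = ((↑) : P.Gp Y → G) ⁻¹' (P.gen '' Y) := by
    ext ⟨g, hg⟩
    simp [inducedGen, Subtype.ext_iff]
  rw [← MonoidHom.range_eq_top, FreeGroup.range_lift_eq_closure, h]
  exact Subgroup.closure_closure_coe_preimage

/-- The presentation of the subgroup `Gp(Y)` on the generators `Y` that is induced by `P`: its
relators are all words in `Y` that equal `1` in `G`. -/
def induced (P : GroupPresentation X G) (Y : Set X) : GroupPresentation Y (P.Gp Y) where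
  rels := (FreeGroup.lift (P.inducedGen Y)).ker
  gen := P.inducedGen Y
  surjective_lift := P.surjective_lift_inducedGen Y
  ker_lift := (Subgroup.normalClosure_eq_self _).symm

/-- A finite subgraph of the Cayley graph of `P`. The Cayley graph has vertex set `G` and, for
every `g : G` and `x : X`, one edge `(g, x)` labeled `x` that starts at `g` and ends at
`g * P.gen x`. It is an undirected multigraph, whose edges are given a direction by their label;
a generator of order `2` gives two edges between `g` and `g * P.gen x`. -/
@[ext]
structure FiniteSubgraph (P : GroupPresentation X G) where
  verts : Finset G
  edges : Finset (G × X)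
  source_mem : ∀ e ∈ edges, e.1 ∈ verts
  target_mem : ∀ e ∈ edges, e.1 * P.gen e.2 ∈ verts

namespace FiniteSubgraph

variable {P : GroupPresentation X G}

/-- The vertices of a finite subgraph, as a type. -/
def Vertex (H : P.FiniteSubgraph) : Type v := {g : G // g ∈ H.verts}

/-- The arrows from `a` to `b` are the edges of the subgraph that start at `a` and end at `b`. -/
instance (H : P.FiniteSubgraph) : Quiver H.Vertex where
  Hom a b := {x : X // (a.1, x) ∈ H.edges ∧ a.1 * P.gen x = b.1}

/-- The set of connected components (edges may be traversed in both directions). -/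
abbrev Components (H : P.FiniteSubgraph) : Type v :=
  Quiver.WeaklyConnectedComponent H.Vertex

/-- A subgraph is connected if it has exactly one component. -/
def IsConnected (H : P.FiniteSubgraph) : Prop :=
  Nonempty H.Components ∧ Subsingleton H.Components

/-- The fundamental group of a subgraph at a vertex: homotopy classes of closed edge paths, where
every edge may be traversed in both directions. It is the vertex group of the free groupoid on the
graph. -/
abbrev fundamentalGroup (H : P.FiniteSubgraph) (a : H.Vertex) : Type (max u v) :=
  CategoryTheory.End ((Quiver.FreeGroupoid.of H.Vertex).obj a)

/-- The number of vertices. -/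
def beta0 (H : P.FiniteSubgraph) : ℕ := H.verts.card

/-- The cyclomatic number: the sum over all components of the rank of the fundamental group. -/
noncomputable def beta2 (H : P.FiniteSubgraph) : ℕ :=
  ∑ᶠ c : H.Components, groupRank (H.fundamentalGroup (Quotient.out c))

noncomputable def xi (H : P.FiniteSubgraph) : ℝ := (H.beta2 : ℝ) / (H.beta0 : ℝ)

/-- Only used for subgraphs with more than one vertex. -/
noncomputable def psi (H : P.FiniteSubgraph) : ℝ := (H.beta2 : ℝ) / ((H.beta0 : ℝ) - 1)

end FiniteSubgraph

/-- An increasing sequence of finite connected subgraphs whose union is the Cayley graph. -/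
structure IsExhaustingChain (P : GroupPresentation X G) (C : ℕ → P.FiniteSubgraph) : Prop where
  connected : ∀ i, (C i).IsConnected
  verts_mono : ∀ i, (C i).verts ⊆ (C (i + 1)).verts
  edges_mono : ∀ i, (C i).edges ⊆ (C (i + 1)).edges
  verts_exhaust : ∀ g : G, ∃ i, g ∈ (C i).verts
  edges_exhaust : ∀ e : G × X, ∃ i, e ∈ (C i).edges

/-- The cyclomatic quotient: the supremum of `limsup xi (C i)` over all exhausting chains `C`.
Suprema are taken in the extended reals, so they always exist. -/
noncomputable def Xi (P : GroupPresentation X G) : EReal :=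
  ⨆ (C : ℕ → P.FiniteSubgraph) (_ : P.IsExhaustingChain C),
    Filter.limsup (fun i => ((C i).xi : EReal)) Filter.atTop

/-- The supremum of `psi` over all finite subgraphs with more than one vertex. For a trivial group
there are none, and the value is `⊥`. -/
noncomputable def Psi (P : GroupPresentation X G) : EReal :=
  ⨆ (H : P.FiniteSubgraph) (_ : 1 < H.beta0), (H.psi : EReal)

/-- The normalization `1 - n + Psi`, where `n` is the number of generators. -/
noncomputable def PsiHat (P : GroupPresentation X G) : EReal :=
  ((1 - (Nat.card X : ℝ) : ℝ) : EReal) + P.Psi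

/-- Among the subsets of the generators that generate a finite subgroup, `Y` has the largest
possible number of elements, and among those with this number of elements its subgroup `Gp(Y)` has
the smallest possible order. -/
structure IsExtremalFinite (P : GroupPresentation X G) (Y : Set X) : Prop where
  finite : Finite (P.Gp Y)
  card_max : ∀ Z : Set X, Finite (P.Gp Z) → Z.ncard ≤ Y.ncard
  order_min : ∀ Z : Set X, Finite (P.Gp Z) → Z.ncard = Y.ncard →
    Nat.card (P.Gp Y) ≤ Nat.card (P.Gp Z)

end GroupPresentation

/-! Write e(S) for the number of edges of the full subgraph on a finite set S of vertices. Euler's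
formula, β₂ + β₀ = edges + components, turns every claim about Ψ into one about e: for q ≥ 0, Ψ ≤ q
holds exactly when e(S) ≤ (1 + q)(|S| − 1) for all finite non-empty S (`Psi_le`,
`IsMinimal.card_inducedEdges_le_of_Psi_le`).

The function e is invariant under left translation and supermodular: e(A) + e(B) ≤ e(A ∪ B) + e(A ∩
B). The recurring argument takes a set that is extremal for some inequality, of least or greatest
size, translated so as to contain 1. Supermodularity forces every translate that meets it to
coincide with it, so it is a subgroup K (`exists_subgroup_coe_eq`). There e(K) = a|K|, where a
counts the generators in K, and |K| ≥ 2^a, because in a minimal presentation each further generator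
at least doubles the order. What remains is arithmetic.

This is used three times. `IsMinimal.card_inducedEdges_add_le` gives e(S) ≤ n(|S| − 1) for proper
finite S, hence Ψ ≤ n − 1 for infinite G, while for finite G the whole group is the maximizer.
`IsMinimal.eq_one_or_eq_two` treats equality for |S| ≥ 2. `IsMinimal.Psi_le_induced` treats Ξ < Ψ:
large connected sets with large quotients could be glued into an exhausting chain (`le_Xi`), so Ψ is
attained, and a largest set attaining it is a finite subgroup, to be compared with H.

For infinite G, Ψ = n − 1 arises from Følner sets or from equality on one finite set; otherwise the
number of edges leaving S is at least ε|S| and, for |S| ≥ 2, at least n + 1, which bounds Ψ away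
from n − 1. Følner sets are matched with invariant means by Hall's theorem in one direction and an
ultralimit of averages in the other. Finally, Ψ = 0 says that all full subgraphs are forests, i.e.
that the generators are a free basis; that n generators of a free group of rank n form a basis is
the Hopf property. -/

section

/-! ### Spanning trees and the rank of a vertex group of a free groupoid -/

/-- A finite connected multigraph has a spanning tree, and along its edges a family of potentials
with prescribed value at the root can be propagated. -/
theorem exists_spanning_tree {C E : Type*} [Fintype C] (s t : E → C)
    (hconn : ∀ A : Set C, A.Nonempty → (∀ e, s e ∈ A ↔ t e ∈ A) → A = Set.univ)
    (D : C → Type*) (τ : ∀ e, D (s e) ≃ D (t e)) (p₀ : ∀ a, D a) (v : C) :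
    ∃ T : Finset E, T.card + 1 = Fintype.card C ∧
      (∀ B : Set C, v ∈ B → (∀ e ∈ T, s e ∈ B ↔ t e ∈ B) → B = Set.univ) ∧
      ∃ p : ∀ a, D a, p v = p₀ v ∧ ∀ e ∈ T, τ e (p (s e)) = p (t e) := by
  classical
  -- The tree grows by one vertex at a time, across an edge with exactly one end in `A`; that edge
  -- determines the potential at the new vertex.
  have key : ∀ k, 1 ≤ k → k ≤ Fintype.card C → ∃ A : Finset C, v ∈ A ∧ A.card = k ∧
      ∃ T : Finset E, T.card + 1 = k ∧ (∀ e ∈ T, s e ∈ A ∧ t e ∈ A) ∧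
      (∀ B : Set C, v ∈ B → (∀ e ∈ T, s e ∈ B ↔ t e ∈ B) → ↑A ⊆ B) ∧
      ∃ p : ∀ a, D a, p v = p₀ v ∧ ∀ e ∈ T, τ e (p (s e)) = p (t e) := by
    intro k hk
    induction k, hk using Nat.le_induction with
    | base =>
      intro _
      exact ⟨{v}, by simp, by simp, ∅, by simp, by simp, by simp, p₀, rfl, by simp⟩
    | succ k hk ih =>
      intro hkC
      obtain ⟨A, hvA, hA, T, hT, hTA, hTB, p, hpv, hp⟩ := ih (by omega)
      have hne : ¬ ∀ e, s e ∈ (A : Set C) ↔ t e ∈ (A : Set C) := by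
        intro h
        have := hconn A ⟨v, hvA⟩ h
        have h2 : A = Finset.univ := by
          exact Finset.coe_eq_univ.1 this
        rw [h2, Finset.card_univ] at hA
        omega
      push Not at hne
      obtain ⟨e, he⟩ := hne
      have heT : e ∉ T := fun h => by
        have := hTA e h
        rcases he with ⟨_, h2⟩ | ⟨h1, _⟩
        · exact h2 this.2
        · exact h1 this.1
      rcases he with ⟨h1, h2⟩ | ⟨h1, h2⟩
      · rw [Finset.mem_coe] at h1 h2
        refine ⟨insert (t e) A, Finset.mem_insert_of_mem hvA, by simp [h2, hA],
          insert e T, by simp [heT, hT], ?_, ?_, Function.update p (t e) (τ e (p (s e))), ?_, ?_⟩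
        · intro f hf
          rcases Finset.mem_insert.1 hf with rfl | hf
          · simp [h1]
          · simp [(hTA f hf).1, (hTA f hf).2]
        · intro B hvB hB
          have hAB := hTB B hvB (fun f hf => hB f (Finset.mem_insert_of_mem hf))
          intro x hx
          rcases Finset.mem_insert.1 (Finset.mem_coe.1 hx) with rfl | hx
          · exact (hB e (Finset.mem_insert_self _ _)).1 (hAB h1)
          · exact hAB hx
        · rw [Function.update_of_ne (ne_of_mem_of_not_mem hvA h2), hpv]
        · intro f hf
          rcases Finset.mem_insert.1 hf with rfl | hf
          · rw [Function.update_self, Function.update_of_ne (ne_of_mem_of_not_mem h1 h2)]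
          · rw [Function.update_of_ne (ne_of_mem_of_not_mem (hTA f hf).1 h2),
              Function.update_of_ne (ne_of_mem_of_not_mem (hTA f hf).2 h2), hp f hf]
      · rw [Finset.mem_coe] at h1 h2
        refine ⟨insert (s e) A, Finset.mem_insert_of_mem hvA, by simp [h1, hA],
          insert e T, by simp [heT, hT], ?_, ?_,
          Function.update p (s e) ((τ e).symm (p (t e))), ?_, ?_⟩
        · intro f hf
          rcases Finset.mem_insert.1 hf with rfl | hf
          · simp [h2]
          · simp [(hTA f hf).1, (hTA f hf).2]
        · intro B hvB hB
          have hAB := hTB B hvB (fun f hf => hB f (Finset.mem_insert_of_mem hf))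
          intro x hx
          rcases Finset.mem_insert.1 (Finset.mem_coe.1 hx) with rfl | hx
          · exact (hB e (Finset.mem_insert_self _ _)).2 (hAB h2)
          · exact hAB hx
        · rw [Function.update_of_ne (ne_of_mem_of_not_mem hvA h1), hpv]
        · intro f hf
          rcases Finset.mem_insert.1 hf with rfl | hf
          · rw [Function.update_self, Function.update_of_ne (ne_of_mem_of_not_mem h2 h1),
              Equiv.apply_symm_apply]
          · rw [Function.update_of_ne (ne_of_mem_of_not_mem (hTA f hf).1 h1),
              Function.update_of_ne (ne_of_mem_of_not_mem (hTA f hf).2 h1), hp f hf]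
  obtain ⟨A, hvA, hA, T, hT, -, hTB, p, hpv, hp⟩ :=
    key (Fintype.card C) (Fintype.card_pos_iff.2 ⟨v⟩) le_rfl
  refine ⟨T, hT, fun B hvB hB => ?_, p, hpv, hp⟩
  have := hTB B hvB hB
  rw [(Finset.card_eq_iff_eq_univ A).1 hA] at this
  simpa [Set.univ_subset_iff] using this

/-- Generating sets of an elementary abelian `2`-group of dimension `|K|` have at least `|K|`
elements. -/
theorem card_le_rank_of_surjective {K : Type*} [Fintype K] {A : Type*} [Group A] [Group.FG A]
    (φ : A →* Multiplicative (K → ZMod 2)) (hφ : Function.Surjective φ) :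
    Fintype.card K ≤ Group.rank A := by
  classical
  obtain ⟨S, hS, hcl⟩ := Group.rank_spec A
  rw [← hS]
  let S' : Finset (K → ZMod 2) := S.image (fun a => (φ a).toAdd)
  have htop : Submodule.span (ZMod 2) (S' : Set (K → ZMod 2)) = ⊤ := by
    rw [eq_top_iff]
    have hmem : ∀ a, (φ a).toAdd ∈ Submodule.span (ZMod 2) (S' : Set (K → ZMod 2)) := by
      intro a
      have : a ∈ Subgroup.closure (S : Set A) := hcl ▸ Subgroup.mem_top a
      induction this using Subgroup.closure_induction with
      | mem y hy => exact Submodule.subset_span (by simpa [S'] using ⟨y, hy, rfl⟩)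
      | one => simp
      | mul y z _ _ hy hz => simpa using Submodule.add_mem _ hy hz
      | inv y _ hy => simpa using Submodule.neg_mem _ hy
    rintro x -
    obtain ⟨a, ha⟩ := hφ (Multiplicative.ofAdd x)
    simpa [ha] using hmem a
  have h1 := finrank_span_finset_le_card (R := ZMod 2) S'
  rw [Set.finrank, htop, finrank_top, Module.finrank_fintype_fun_eq_card] at h1
  exact h1.trans Finset.card_image_le

section FreeGroupoidRank

open CategoryTheory Quiver

variable {V : Type u} [Quiver.{v} V]

theorem weaklyConnectedComponent_eq_of_hom {a b : V} (f : a ⟶ b) :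
    WeaklyConnectedComponent.mk b = WeaklyConnectedComponent.mk a :=
  (WeaklyConnectedComponent.eq _ _).2 ⟨(Quiver.Hom.toNeg f).toPath⟩

/-- Induction on edge paths that represent a morphism of the free groupoid. -/
theorem freeGroupoid_induction
    {motive : ∀ a b : V, ((FreeGroupoid.of V).obj a ⟶ (FreeGroupoid.of V).obj b) → Prop}
    (id : ∀ a, motive a a (𝟙 _))
    (comp_map : ∀ (a b c : V) (f : (FreeGroupoid.of V).obj a ⟶ (FreeGroupoid.of V).obj b)
      (e : b ⟶ c), motive a b f → motive a c (f ≫ (FreeGroupoid.of V).map e))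
    (comp_inv : ∀ (a b c : V) (f : (FreeGroupoid.of V).obj a ⟶ (FreeGroupoid.of V).obj b)
      (e : c ⟶ b), motive a b f → motive a c (f ≫ inv ((FreeGroupoid.of V).map e)))
    (a b : V) (f : (FreeGroupoid.of V).obj a ⟶ (FreeGroupoid.of V).obj b) : motive a b f := by
  obtain ⟨p, rfl⟩ := Quot.exists_rep f
  change @Path (Symmetrify V) _ a b at p
  have key : ∀ b' : V, ∀ p : @Path (Symmetrify V) _ a b', motive a b' (Quot.mk _ p) := by
    intro b' p
    induction p with
    | nil => exact id a
    | cons q e ih =>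
      rcases e with e | e
      · exact comp_map _ _ _ _ e ih
      · have := comp_inv _ _ _ _ e ih
        rw [← Groupoid.inv_eq_inv] at this
        exact this
  exact key b p

/-- Labels of the arrows in a group extend to the free groupoid. -/
theorem exists_freeGroupoid_labelling {A : Type*} [Group A] (χ : ∀ a b : V, (a ⟶ b) → A) :
    ∃ l : ∀ a b : V, ((FreeGroupoid.of V).obj a ⟶ (FreeGroupoid.of V).obj b) → A,
      (∀ a, l a a (𝟙 _) = 1) ∧
      (∀ a b c (f : (FreeGroupoid.of V).obj a ⟶ (FreeGroupoid.of V).obj b)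
        (g : (FreeGroupoid.of V).obj b ⟶ (FreeGroupoid.of V).obj c),
        l a c (f ≫ g) = l b c g * l a b f) ∧
      ∀ a b (e : a ⟶ b), l a b ((FreeGroupoid.of V).map e) = χ a b e := by
  let φ : V ⥤q CategoryTheory.SingleObj A :=
    { obj := fun _ => CategoryTheory.SingleObj.star A
      map := fun {a b} f => χ a b f }
  let Φ : Quiver.FreeGroupoid V ⥤ CategoryTheory.SingleObj A := FreeGroupoid.lift φ
  refine ⟨fun a b f => Φ.map f, fun a => Φ.map_id _, fun a b c f g => Φ.map_comp f g,
    fun a b e => ?_⟩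
  change Φ.map ((FreeGroupoid.of V).map e) = φ.map e
  change 𝟙 _ ≫ φ.map e = φ.map e
  exact Category.id_comp _

theorem mem_of_path {A : Set V} (hA : ∀ (a b : V), (a ⟶ b) → (a ∈ A ↔ b ∈ A)) {a b : V}
    (p : @Path (Symmetrify V) _ a b) (ha : a ∈ A) : b ∈ A := by
  induction p with
  | nil => exact ha
  | cons q e ih =>
    rcases e with e | e
    · exact (hA _ _ e).1 ih
    · exact (hA _ _ e).2 ih

/-- A spanning tree gives one loop for each edge outside it. These loops generate the vertex group,
and counting such edges mod 2 maps the group onto (ℤ/2)^K, where K is the set of non-tree edges, so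
no smaller set generates. Freeness of the group is not needed. -/
theorem groupRank_freeGroupoid [Finite V] [∀ a b : V, Finite (a ⟶ b)] (v : V) :
    groupRank (End ((FreeGroupoid.of V).obj v)) +
        Nat.card {a : V // WeaklyConnectedComponent.mk a = WeaklyConnectedComponent.mk v} =
      Nat.card {e : Σ a b : V, (a ⟶ b) //
        WeaklyConnectedComponent.mk e.1 = WeaklyConnectedComponent.mk v} + 1 := by
  classical
  let C := {a : V // WeaklyConnectedComponent.mk a = WeaklyConnectedComponent.mk v}
  let E := {e : Σ a b : V, (a ⟶ b) //
    WeaklyConnectedComponent.mk e.1 = WeaklyConnectedComponent.mk v}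
  have : Fintype C := Fintype.ofFinite _
  have : Fintype E := Fintype.ofFinite _
  let s : E → C := fun e => ⟨e.1.1, e.2⟩
  let t : E → C := fun e => ⟨e.1.2.1, (weaklyConnectedComponent_eq_of_hom e.1.2.2).trans e.2⟩
  let v₀ : C := ⟨v, rfl⟩
  let D : C → Type _ := fun a => (FreeGroupoid.of V).obj v ⟶ (FreeGroupoid.of V).obj a.1
  let m : ∀ e : E, (FreeGroupoid.of V).obj (s e).1 ⟶ (FreeGroupoid.of V).obj (t e).1 :=
    fun e => (FreeGroupoid.of V).map e.1.2.2
  let τ : ∀ e, D (s e) ≃ D (t e) := fun e =>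
    { toFun := fun f => f ≫ m e
      invFun := fun f => f ≫ inv (m e)
      left_inv := fun f => by simp
      right_inv := fun f => by simp }
  have hconn : ∀ A : Set C, A.Nonempty → (∀ e, s e ∈ A ↔ t e ∈ A) → A = Set.univ := by
    rintro A ⟨a, ha⟩ hA
    refine Set.eq_univ_of_forall fun b => ?_
    obtain ⟨p⟩ := (WeaklyConnectedComponent.eq a.1 b.1).1 (a.2.trans b.2.symm)
    have : b.1 ∈ {x : V | ∃ h, (⟨x, h⟩ : C) ∈ A} := by
      refine mem_of_path ?_ p ⟨a.2, ha⟩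
      intro x y f
      constructor
      · rintro ⟨h, hx⟩
        exact ⟨_, (hA ⟨⟨x, y, f⟩, h⟩).1 hx⟩
      · rintro ⟨h, hy⟩
        have h' := (weaklyConnectedComponent_eq_of_hom f).symm.trans h
        exact ⟨h', (hA ⟨⟨x, y, f⟩, h'⟩).2 hy⟩
    obtain ⟨h, hb⟩ := this
    exact hb
  have hD : ∀ a : C, Nonempty (D a) := fun a => by
    obtain ⟨p⟩ := (WeaklyConnectedComponent.eq v a.1).1 a.2.symm
    exact ⟨Quot.mk _ p⟩
  let q : ∀ a, D a := fun a => (hD a).some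
  -- The potential `p a` is the path from `v` to `a` inside the tree; the prescribed values are
  -- normalized to be the identity at `v`.
  obtain ⟨T, hT, hTB, p, hpv, hp⟩ :=
    exists_spanning_tree s t hconn D τ (fun a => inv (q v₀) ≫ q a) v₀
  replace hpv : p v₀ = 𝟙 _ := by rw [hpv]; exact IsIso.inv_hom_id _
  -- Out along the tree, across `e`, back along the tree; trivial when `e` is itself in the tree.
  let ℓ : E → End ((FreeGroupoid.of V).obj v) := fun e => p (s e) ≫ m e ≫ inv (p (t e))
  have hℓT : ∀ e ∈ T, ℓ e = 1 := by
    intro e he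
    have h : p (s e) ≫ m e = p (t e) := hp e he
    change p (s e) ≫ m e ≫ inv (p (t e)) = 𝟙 _
    rw [← Category.assoc, h, IsIso.hom_inv_id]
  let S : Finset (End ((FreeGroupoid.of V).obj v)) := (Finset.univ \ T).image ℓ
  let N : ((FreeGroupoid.of V).obj v ⟶ (FreeGroupoid.of V).obj v) → Prop := fun f =>
    (f : End ((FreeGroupoid.of V).obj v)) ∈
      Subgroup.closure (S : Set (End ((FreeGroupoid.of V).obj v)))
  have hN1 : N (𝟙 _) := one_mem (Subgroup.closure (S : Set (End ((FreeGroupoid.of V).obj v))))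
  have hNmul : ∀ f g, N f → N g → N (f ≫ g) := fun f g hf hg =>
    Subgroup.mul_mem (G := End ((FreeGroupoid.of V).obj v)) _ hg hf
  have hNinv : ∀ f, N f → N (inv f) := fun f hf => by
    rw [← Groupoid.inv_eq_inv]
    exact Subgroup.inv_mem (G := End ((FreeGroupoid.of V).obj v)) _ hf
  have hℓ : ∀ e, N (ℓ e) := by
    intro e
    by_cases he : e ∈ T
    · rw [hℓT e he]; exact hN1
    · exact Subgroup.subset_closure (Finset.mem_coe.2 (Finset.mem_image_of_mem _ (by simp [he])))
  have hgen : ∀ (a b : V) (f : (FreeGroupoid.of V).obj a ⟶ (FreeGroupoid.of V).obj b) (ha hb),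
      N (p ⟨a, ha⟩ ≫ f ≫ inv (p ⟨b, hb⟩)) := by
    intro a b f
    induction a, b, f using freeGroupoid_induction with
    | id a =>
      intro ha hb
      rw [Category.id_comp, IsIso.hom_inv_id]
      exact hN1
    | comp_map a b c f e ih =>
      intro ha hc
      have hb := (weaklyConnectedComponent_eq_of_hom e).symm.trans hc
      have h := hNmul _ _ (ih ha hb) (hℓ ⟨⟨b, c, e⟩, hb⟩)
      simpa [ℓ, m, s, t] using h
    | comp_inv a b c f e ih =>
      intro ha hc
      have hb := (weaklyConnectedComponent_eq_of_hom e).trans hc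
      have h := hNmul _ _ (ih ha hb) (hNinv _ (hℓ ⟨⟨c, b, e⟩, hc⟩))
      simpa [ℓ, m, s, t] using h
  have htop : Subgroup.closure (S : Set (End ((FreeGroupoid.of V).obj v))) = ⊤ := by
    rw [eq_top_iff]
    rintro f -
    have h : N (p v₀ ≫ f ≫ inv (p v₀)) := hgen v v f rfl rfl
    rw [hpv, IsIso.inv_id, Category.id_comp, Category.comp_id] at h
    exact h
  have hFG : Group.FG (End ((FreeGroupoid.of V).obj v)) := Group.fg_iff'.2 ⟨_, S, rfl, htop⟩
  have hupper : Group.rank (End ((FreeGroupoid.of V).obj v)) ≤ (Finset.univ \ T).card :=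
    (Group.rank_le htop).trans Finset.card_image_le
  let K := {e : E // e ∉ T}
  -- The label of a non-tree edge is its basis vector; tree edges get the label 1.
  let χ : (Σ a b : V, (a ⟶ b)) → Multiplicative (K → ZMod 2) := fun e =>
    Multiplicative.ofAdd fun k => if k.1.1 = e then 1 else 0
  have hχT : ∀ e ∈ T, χ e.1 = 1 := fun e he => by
    refine congrArg Multiplicative.ofAdd (funext fun k => if_neg fun h => k.2 ?_)
    rwa [Subtype.ext h]
  obtain ⟨l, hl1, hlmul, hlmap⟩ := exists_freeGroupoid_labelling (fun a b e => χ ⟨a, b, e⟩)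
  have hlinv : ∀ a b (f : (FreeGroupoid.of V).obj a ⟶ (FreeGroupoid.of V).obj b),
      l b a (inv f) = (l a b f)⁻¹ := fun a b f => by
    rw [eq_inv_iff_mul_eq_one, ← hlmul, IsIso.hom_inv_id, hl1]
  -- The vertices whose tree path has trivial label include `v` and are closed under tree edges.
  have hlp : ∀ a : C, l v a.1 (p a) = 1 := by
    have := hTB {a | l v a.1 (p a) = 1} (by
      change l v v (p v₀) = 1
      rw [hpv, hl1]) (fun e he => by
        have h : p (s e) ≫ m e = p (t e) := hp e he
        change l v (s e).1 (p (s e)) = 1 ↔ l v (t e).1 (p (t e)) = 1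
        rw [← h, hlmul, hlmap, show χ _ = 1 from hχT e he, one_mul])
    intro a
    exact Set.eq_univ_iff_forall.1 this a
  let φ : End ((FreeGroupoid.of V).obj v) →* Multiplicative (K → ZMod 2) :=
    { toFun := l v v
      map_one' := hl1 v
      map_mul' := fun f g => hlmul v v v g f }
  have hφℓ : ∀ e, φ (ℓ e) = χ e.1 := fun e => by
    change l v v (p (s e) ≫ m e ≫ inv (p (t e))) = _
    rw [hlmul, hlmul, hlinv, hlp, hlp, hlmap, inv_one, one_mul, mul_one]
  have hsurj : Function.Surjective φ := by
    intro x
    change x ∈ Set.range φ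
    rw [← MonoidHom.coe_range, SetLike.mem_coe]
    have hx : x = ∏ k : K, Multiplicative.ofAdd (Pi.single k (x.toAdd k)) := by
      rw [← ofAdd_sum, Finset.univ_sum_single]; rfl
    rw [hx]
    refine Subgroup.prod_mem _ fun k _ => ?_
    rcases (by decide : ∀ z : ZMod 2, z = 0 ∨ z = 1) (x.toAdd k) with h | h
    · rw [h, Pi.single_zero]; exact one_mem _
    · refine ⟨ℓ k.1, ?_⟩
      rw [hφℓ, h]
      refine congrArg Multiplicative.ofAdd (funext fun j => ?_)
      rw [Pi.single_apply]
      simp only [← Subtype.ext_iff, eq_comm]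
  have hlower := card_le_rank_of_surjective φ hsurj
  have hK : Fintype.card K = (Finset.univ \ T).card := by
    rw [Fintype.card_subtype]
    congr 1
    ext; simp
  have hTle : (Finset.univ \ T).card + T.card = Fintype.card E := by
    rw [Finset.card_sdiff_of_subset (Finset.subset_univ T), Finset.card_univ]
    exact Nat.sub_add_cancel (Finset.card_le_univ T)
  rw [groupRank, dif_pos hFG, Nat.card_eq_fintype_card (α := C), Nat.card_eq_fintype_card (α := E)]
  omega

end FreeGroupoidRank

end

/-! ### Euler's formula and the reduction of Ψ to edge counts of full subgraphs -/

namespace GroupPresentation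

variable {X : Type u} {G : Type v} [Group G]

open Classical in
/-- The edges of the full subgraph of the Cayley graph on a finite set of vertices. -/
noncomputable def inducedEdges (P : GroupPresentation X G) [Finite X] (S : Finset G) :
    Finset (G × X) :=
  letI := Fintype.ofFinite X
  (S ×ˢ Finset.univ).filter fun e => e.1 * P.gen e.2 ∈ S

theorem mem_inducedEdges {P : GroupPresentation X G} [Finite X] {S : Finset G} {e : G × X} :
    e ∈ P.inducedEdges S ↔ e.1 ∈ S ∧ e.1 * P.gen e.2 ∈ S := by
  simp [inducedEdges]

/-- The full subgraph on a finite set of vertices. -/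
noncomputable def fullSubgraph (P : GroupPresentation X G) [Finite X] (S : Finset G) :
    P.FiniteSubgraph where
  verts := S
  edges := P.inducedEdges S
  source_mem _ he := (mem_inducedEdges.1 he).1
  target_mem _ he := (mem_inducedEdges.1 he).2

namespace FiniteSubgraph

open CategoryTheory Quiver

variable {P : GroupPresentation X G}

instance (H : P.FiniteSubgraph) : Finite H.Vertex :=
  inferInstanceAs (Finite {g : G // g ∈ H.verts})

/-- Arrows of a subgraph, with their ends, are edges. -/
def arrowEquiv (H : P.FiniteSubgraph) : (Σ a b : H.Vertex, (a ⟶ b)) ≃ {e // e ∈ H.edges} where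
  toFun f := ⟨(f.1.1, f.2.2.1), f.2.2.2.1⟩
  invFun e := ⟨⟨e.1.1, H.source_mem _ e.2⟩, ⟨e.1.1 * P.gen e.1.2, H.target_mem _ e.2⟩,
    ⟨e.1.2, e.2, rfl⟩⟩
  left_inv := by
    rintro ⟨⟨a, ha⟩, ⟨b, hb⟩, ⟨x, hx, hxb⟩⟩
    dsimp only at hx hxb
    subst hxb
    rfl
  right_inv e := rfl

instance (H : P.FiniteSubgraph) : Finite (Σ a b : H.Vertex, (a ⟶ b)) :=
  Finite.of_equiv _ H.arrowEquiv.symm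

instance (H : P.FiniteSubgraph) (a b : H.Vertex) : Finite (a ⟶ b) :=
  Finite.of_injective (fun f => (⟨a, b, f⟩ : Σ a b : H.Vertex, (a ⟶ b))) fun f g h => by
    simpa using h

instance (H : P.FiniteSubgraph) : Finite H.Components :=
  Finite.of_surjective (fun a : H.Vertex => (WeaklyConnectedComponent.mk a : H.Components))
    Quotient.mk_surjective

theorem rank_component (H : P.FiniteSubgraph) (c : H.Components) :
    groupRank (H.fundamentalGroup (Quotient.out c)) +
        Nat.card {a : H.Vertex // WeaklyConnectedComponent.mk a = c} =
      Nat.card {e : Σ a b : H.Vertex, (a ⟶ b) // WeaklyConnectedComponent.mk e.1 = c} + 1 := by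
  have h := groupRank_freeGroupoid (V := H.Vertex) (Quotient.out c)
  rw [show WeaklyConnectedComponent.mk (Quotient.out c) = c from Quotient.out_eq c] at h
  exact h

theorem sum_card_fiber {ι : Type*} (H : P.FiniteSubgraph) [Fintype H.Components] [Finite ι]
    (f : ι → H.Components) : ∑ c, Nat.card {a // f a = c} = Nat.card ι := by
  rw [← Nat.card_sigma]
  exact Nat.card_congr (Equiv.sigmaFiberEquiv f)

theorem card_vertex (H : P.FiniteSubgraph) : Nat.card H.Vertex = H.beta0 :=
  Nat.card_eq_finsetCard H.verts

/-- Euler's formula: the rank formula of each component, summed over the components. -/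
theorem beta2_add_beta0 (H : P.FiniteSubgraph) :
    H.beta2 + H.beta0 = H.edges.card + Nat.card H.Components := by
  have : Fintype H.Components := Fintype.ofFinite _
  rw [beta2, finsum_eq_sum_of_fintype, ← card_vertex,
    ← H.sum_card_fiber (fun a : H.Vertex => WeaklyConnectedComponent.mk a),
    ← Finset.sum_add_distrib, Finset.sum_congr rfl fun c _ => H.rank_component c,
    Finset.sum_add_distrib, H.sum_card_fiber, Nat.card_congr H.arrowEquiv,
    Nat.card_eq_finsetCard]
  simp

theorem beta2_add_beta0_of_isConnected {H : P.FiniteSubgraph} (hH : H.IsConnected) :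
    H.beta2 + H.beta0 = H.edges.card + 1 := by
  obtain ⟨h1, h2⟩ := hH
  rw [beta2_add_beta0, Nat.card_eq_one_iff_unique.2 ⟨h2, h1⟩]

theorem card_edges_lt_beta2_add_beta0 {H : P.FiniteSubgraph} (hH : H.verts.Nonempty) :
    H.edges.card + 1 ≤ H.beta2 + H.beta0 := by
  obtain ⟨g, hg⟩ := hH
  have : Nonempty H.Components := ⟨WeaklyConnectedComponent.mk (⟨g, hg⟩ : H.Vertex)⟩
  have := Nat.card_pos (α := H.Components)
  rw [beta2_add_beta0]
  omega

/-- Passing from a component to the full subgraph on its vertices can only add edges; hence full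
subgraphs suffice for upper bounds. -/
theorem exists_component_verts [Finite X] (H : P.FiniteSubgraph) (c : H.Components) :
    ∃ S : Finset G, S.Nonempty ∧
      Nat.card {a : H.Vertex // WeaklyConnectedComponent.mk a = c} = S.card ∧
      Nat.card {e : Σ a b : H.Vertex, (a ⟶ b) // WeaklyConnectedComponent.mk e.1 = c} ≤
        (P.inducedEdges S).card := by
  classical
  have : Fintype {a : H.Vertex // WeaklyConnectedComponent.mk a = c} := Fintype.ofFinite _
  let f : {a : H.Vertex // WeaklyConnectedComponent.mk a = c} → G := fun a => a.1.1
  have hf : Function.Injective f := fun a b h => Subtype.ext (Subtype.ext h)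
  refine ⟨Finset.univ.image f, ?_, ?_, ?_⟩
  · obtain ⟨a, ha⟩ := Quotient.exists_rep c
    exact ⟨_, Finset.mem_image_of_mem f (Finset.mem_univ ⟨a, ha⟩)⟩
  · rw [Finset.card_image_of_injective _ hf, Finset.card_univ, Nat.card_eq_fintype_card]
  · rw [← Nat.card_eq_finsetCard]
    refine Nat.card_le_card_of_injective (fun e => ⟨(H.arrowEquiv e.1).1, ?_⟩) ?_
    · obtain ⟨⟨a, b, e⟩, he⟩ := e
      refine mem_inducedEdges.2 ⟨Finset.mem_image_of_mem f (Finset.mem_univ ⟨a, he⟩), ?_⟩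
      change a.1 * P.gen e.1 ∈ _
      rw [e.2.2]
      exact Finset.mem_image_of_mem f
        (Finset.mem_univ ⟨b, (weaklyConnectedComponent_eq_of_hom e).trans he⟩)
    · intro e e' h
      exact Subtype.ext (H.arrowEquiv.injective (Subtype.ext (Subtype.mk.inj h)))

/-- A component with v vertices contributes at most q(v − 1). The sum is q times (vertices minus
components), and since q ≥ 0 it is largest for a single component. -/
theorem beta2_le [Finite X] {q : ℝ} (hq : 0 ≤ q)
    (hE : ∀ S : Finset G, S.Nonempty →
      ((P.inducedEdges S).card : ℝ) ≤ (1 + q) * ((S.card : ℝ) - 1))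
    (H : P.FiniteSubgraph) (hH : H.verts.Nonempty) :
    (H.beta2 : ℝ) ≤ q * ((H.beta0 : ℝ) - 1) := by
  have : Fintype H.Components := Fintype.ofFinite _
  obtain ⟨g, hg⟩ := hH
  have : Nonempty H.Components := ⟨WeaklyConnectedComponent.mk (⟨g, hg⟩ : H.Vertex)⟩
  have hC : (1 : ℝ) ≤ (Fintype.card H.Components : ℝ) := by
    exact_mod_cast Fintype.card_pos (α := H.Components)
  have hc : ∀ c : H.Components, (groupRank (H.fundamentalGroup (Quotient.out c)) : ℝ) ≤
      q * ((Nat.card {a : H.Vertex // WeaklyConnectedComponent.mk a = c} : ℝ) - 1) := by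
    intro c
    obtain ⟨S, hS, hV, hEc⟩ := H.exists_component_verts c
    have h1 : (groupRank (H.fundamentalGroup (Quotient.out c)) : ℝ) +
        (Nat.card {a : H.Vertex // WeaklyConnectedComponent.mk a = c} : ℝ) =
        (Nat.card {e : Σ a b : H.Vertex, (a ⟶ b) // WeaklyConnectedComponent.mk e.1 = c} : ℝ)
          + 1 := by
      exact_mod_cast H.rank_component c
    have h2 : (Nat.card {e : Σ a b : H.Vertex, (a ⟶ b) // WeaklyConnectedComponent.mk e.1 = c} : ℝ)
        ≤ ((P.inducedEdges S).card : ℝ) := by exact_mod_cast hEc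
    have h3 := hE S hS
    rw [hV] at h1 ⊢
    linarith
  rw [beta2, finsum_eq_sum_of_fintype, Nat.cast_sum]
  refine (Finset.sum_le_sum fun c _ => hc c).trans ?_
  rw [← Finset.mul_sum, Finset.sum_sub_distrib, ← Nat.cast_sum, H.sum_card_fiber, card_vertex]
  refine mul_le_mul_of_nonneg_left ?_ hq
  simp only [Finset.sum_const, Finset.card_univ, nsmul_eq_mul, mul_one]
  linarith

end FiniteSubgraph

theorem Psi_le [Finite X] (P : GroupPresentation X G) {q : ℝ} (hq : 0 ≤ q)
    (hE : ∀ S : Finset G, S.Nonempty →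
      ((P.inducedEdges S).card : ℝ) ≤ (1 + q) * ((S.card : ℝ) - 1)) :
    P.Psi ≤ (q : EReal) := by
  refine iSup₂_le fun H hH => ?_
  rw [EReal.coe_le_coe_iff, FiniteSubgraph.psi]
  have h1 : (1 : ℝ) < (H.beta0 : ℝ) := by exact_mod_cast hH
  rw [div_le_iff₀ (by linarith)]
  exact H.beta2_le hq hE (Finset.card_pos.1 (by unfold FiniteSubgraph.beta0 at hH; omega))

/-- The full subgraph on `S` competes in the supremum; being disconnected would only increase its β₂
beyond edges − vertices + 1. -/
theorem le_Psi [Finite X] (P : GroupPresentation X G) {S : Finset G} (hS : 1 < S.card) :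
    (((((P.inducedEdges S).card : ℝ) - S.card + 1) / ((S.card : ℝ) - 1) : ℝ) : EReal) ≤ P.Psi := by
  refine le_trans ?_ (le_iSup₂_of_le (P.fullSubgraph S) hS le_rfl)
  rw [EReal.coe_le_coe_iff, FiniteSubgraph.psi]
  have h1 : (1 : ℝ) < (S.card : ℝ) := by exact_mod_cast hS
  have h2 := FiniteSubgraph.card_edges_lt_beta2_add_beta0 (H := P.fullSubgraph S)
    (Finset.card_pos.1 (lt_trans zero_lt_one hS))
  have h3 : (((P.inducedEdges S).card : ℝ) + 1) ≤ ((P.fullSubgraph S).beta2 : ℝ) + S.card := by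
    exact_mod_cast h2
  change _ ≤ ((P.fullSubgraph S).beta2 : ℝ) / ((S.card : ℝ) - 1)
  exact div_le_div_of_nonneg_right (by linarith) (by linarith)

end GroupPresentation

/-! ### Minimality, supermodularity and edge connectivity -/

section

open scoped Pointwise

/-- A finite set that contains `1` and meets none of its translates properly is a subgroup. -/
theorem exists_subgroup_coe_eq {G : Type*} [Group G] [DecidableEq G] {S : Finset G}
    (h1 : (1 : G) ∈ S) (h : ∀ g : G, (g • S ∩ S).Nonempty → g • S = S) :
    ∃ K : Subgroup G, (K : Set G) = S := by
  have hS : ∀ g ∈ S, g • S = S := fun g hg =>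
    h g ⟨g, Finset.mem_inter.2 ⟨by simpa using Finset.smul_mem_smul_finset (a := g) h1, hg⟩⟩
  refine ⟨{ carrier := S, mul_mem' := ?_, one_mem' := h1, inv_mem' := ?_ }, rfl⟩
  · intro a b ha hb
    have := Finset.smul_mem_smul_finset (a := a) (Finset.mem_coe.1 hb)
    rwa [hS a ha] at this
  · intro a ha
    have : (1 : G) ∈ a • S := by rwa [hS a ha]
    rw [← Finset.inv_smul_mem_iff] at this
    simpa using this

namespace GroupPresentation

variable {X : Type u} {G : Type v} [Group G] {P : GroupPresentation X G}

theorem Gp_mono (P : GroupPresentation X G) {Y Z : Set X} (h : Y ⊆ Z) : P.Gp Y ≤ P.Gp Z :=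
  Subgroup.closure_mono (Set.image_mono h)

theorem gen_mem_Gp (P : GroupPresentation X G) {Y : Set X} {x : X} (h : x ∈ Y) :
    P.gen x ∈ P.Gp Y :=
  Subgroup.subset_closure ⟨x, h, rfl⟩

theorem closure_range_gen (P : GroupPresentation X G) :
    Subgroup.closure (Set.range P.gen) = ⊤ := by
  rw [← FreeGroup.range_lift_eq_closure, MonoidHom.range_eq_top]
  exact P.surjective_lift

theorem Gp_univ (P : GroupPresentation X G) : P.Gp Set.univ = ⊤ := by
  rw [Gp, Set.image_univ, closure_range_gen]

theorem eq_top_of_gen_mem (P : GroupPresentation X G) {K : Subgroup G} (h : ∀ x, P.gen x ∈ K) :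
    K = ⊤ := by
  rw [eq_top_iff, ← P.closure_range_gen, Subgroup.closure_le]
  rintro _ ⟨x, rfl⟩
  exact h x

namespace IsMinimal

/-- Otherwise the generators other than `x` would already generate `G`. -/
theorem gen_notMem_Gp (hP : P.IsMinimal) {Y : Set X} {x : X} (hx : x ∉ Y) :
    P.gen x ∉ P.Gp Y := by
  intro h
  refine hP {x}ᶜ (by simp) (P.eq_top_of_gen_mem fun y => ?_)
  by_cases hy : y = x
  · subst hy
    have hY : Y ⊆ {y}ᶜ := Set.subset_compl_singleton_iff.2 hx
    exact P.Gp_mono hY h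
  · exact P.gen_mem_Gp hy

theorem gen_ne_one (hP : P.IsMinimal) (x : X) : P.gen x ≠ 1 := fun h =>
  hP.gen_notMem_Gp (Set.notMem_empty x) (h ▸ one_mem _)

theorem gen_injective (hP : P.IsMinimal) : Function.Injective P.gen := by
  intro x y h
  by_contra hne
  exact hP.gen_notMem_Gp (Y := {y}) hne (h ▸ P.gen_mem_Gp rfl)

theorem induced (hP : P.IsMinimal) (Y : Set X) : (P.induced Y).IsMinimal := by
  intro Z hZ hZtop
  obtain ⟨y, hy⟩ := (Set.ne_univ_iff_exists_notMem Z).1 hZ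
  have h1 : P.inducedGen Y y ∈ (P.induced Y).Gp Z := hZtop ▸ Subgroup.mem_top _
  have h2 : P.gen y ∈ (Subgroup.closure (P.inducedGen Y '' Z)).map (P.Gp Y).subtype := ⟨_, h1, rfl⟩
  rw [MonoidHom.map_closure, ← Set.image_comp] at h2
  refine hP.gen_notMem_Gp (Y := (↑) '' Z) (x := y) ?_ ?_
  · rintro ⟨z, hz, h⟩
    exact hy (Subtype.ext h ▸ hz)
  · rw [GroupPresentation.Gp, ← Set.image_comp]
    exact h2

/-- By `gen_notMem_Gp` each added generator enlarges the subgroup properly, so by Lagrange the order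
at least doubles. -/
theorem two_pow_le (hP : P.IsMinimal) (Y : Finset X) (hY : Finite (P.Gp (Y : Set X))) :
    2 ^ Y.card ≤ Nat.card (P.Gp (Y : Set X)) := by
  classical
  induction Y using Finset.induction_on with
  | empty => exact Nat.card_pos
  | insert x Y hx ih =>
    have hle : P.Gp (Y : Set X) ≤ P.Gp ((insert x Y : Finset X) : Set X) :=
      P.Gp_mono (by simp)
    have hfin : Finite (P.Gp (Y : Set X)) :=
      Finite.of_injective _ (Subgroup.inclusion_injective hle)
    have h1 := ih hfin
    obtain ⟨k, hk⟩ := Subgroup.card_dvd_of_le hle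
    have hne : k ≠ 1 := fun h => by
      have := Subgroup.eq_of_le_of_card_ge hle (by rw [hk, h, mul_one])
      exact hP.gen_notMem_Gp (Y := (Y : Set X)) (x := x) (by simpa using hx)
        (this ▸ P.gen_mem_Gp (by simp))
    have h0 : k ≠ 0 := fun h => by
      rw [h, mul_zero] at hk
      exact Nat.card_pos.ne' hk
    rw [Finset.card_insert_of_notMem hx, pow_succ, hk]
    exact Nat.mul_le_mul h1 (by omega)

theorem two_pow_ncard_le [Finite X] (hP : P.IsMinimal) (Y : Set X) (hY : Finite (P.Gp Y)) :
    2 ^ Y.ncard ≤ Nat.card (P.Gp Y) := by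
  have h := hP.two_pow_le Y.toFinite.toFinset (by rwa [Set.Finite.coe_toFinset])
  rwa [Set.Finite.coe_toFinset, ← Set.ncard_eq_toFinset_card] at h

end IsMinimal

theorem inducedEdges_mono [Finite X] (P : GroupPresentation X G) {A B : Finset G} (h : A ⊆ B) :
    P.inducedEdges A ⊆ P.inducedEdges B := by
  intro e he
  rw [mem_inducedEdges] at he ⊢
  exact ⟨h he.1, h he.2⟩

section Count

variable [Finite X] [DecidableEq G]

theorem card_inducedEdges_eq_sum [Fintype X] (P : GroupPresentation X G) (S : Finset G) :
    (P.inducedEdges S).card = ∑ x, (S.filter fun g => g * P.gen x ∈ S).card := by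
  classical
  rw [← Finset.card_sigma]
  refine Finset.card_bij' (fun e _ => ⟨e.2, e.1⟩) (fun e _ => (e.2, e.1)) ?_ ?_ ?_ ?_ <;>
    simp [mem_inducedEdges]

theorem card_inducedEdges_le (P : GroupPresentation X G) (S : Finset G) :
    (P.inducedEdges S).card ≤ Nat.card X * S.card := by
  have := Fintype.ofFinite X
  rw [P.card_inducedEdges_eq_sum, Nat.card_eq_fintype_card]
  refine (Finset.sum_le_card_nsmul _ _ S.card fun x _ => Finset.card_filter_le _ _).trans ?_
  simp

theorem card_inducedEdges_smul (P : GroupPresentation X G) (g : G) (S : Finset G) :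
    (P.inducedEdges (g • S)).card = (P.inducedEdges S).card := by
  symm
  refine Finset.card_bij' (fun e _ => (g * e.1, e.2)) (fun e _ => (g⁻¹ * e.1, e.2)) ?_ ?_ ?_ ?_
  · simp only [mem_inducedEdges]
    intro e he
    rw [mul_assoc]
    exact ⟨Finset.smul_mem_smul_finset he.1, Finset.smul_mem_smul_finset he.2⟩
  · simp only [mem_inducedEdges]
    intro e he
    rw [mul_assoc]
    exact ⟨Finset.inv_smul_mem_iff.2 he.1, Finset.inv_smul_mem_iff.2 he.2⟩
  · simp
  · simp

/-- Supermodularity: an edge inside `A` or inside `B` is inside the union, and an edge inside both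
is inside the intersection. -/
theorem card_inducedEdges_add_le (P : GroupPresentation X G) (A B : Finset G) :
    (P.inducedEdges A).card + (P.inducedEdges B).card ≤
      (P.inducedEdges (A ∪ B)).card + (P.inducedEdges (A ∩ B)).card := by
  classical
  rw [← Finset.card_union_add_card_inter]
  refine add_le_add (Finset.card_le_card ?_) (Finset.card_le_card ?_)
  · intro e he
    simp only [Finset.mem_union, mem_inducedEdges] at he ⊢
    tauto
  · intro e he
    simp only [Finset.mem_inter, mem_inducedEdges] at he ⊢
    tauto

/-- From a vertex of `K`, the edges labeled by generators in `K` stay in `K` and all others leave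
it. -/
theorem card_inducedEdges_subgroup (P : GroupPresentation X G) {S : Finset G} {K : Subgroup G}
    (hK : (K : Set G) = S) :
    (P.inducedEdges S).card = {x | P.gen x ∈ K}.ncard * S.card := by
  classical
  have := Fintype.ofFinite X
  have hm : ∀ g, g ∈ S ↔ g ∈ K := fun g => by
    rw [← Finset.mem_coe, ← hK, SetLike.mem_coe]
  have : ∀ x, (S.filter fun g => g * P.gen x ∈ S).card = if P.gen x ∈ K then S.card else 0 := by
    intro x
    split_ifs with h
    · congr 1
      refine Finset.filter_true_of_mem fun g hg => ?_
      rw [hm] at hg ⊢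
      exact mul_mem hg h
    · rw [Finset.card_eq_zero]
      refine Finset.filter_false_of_mem fun g hg hg' => h ?_
      rw [hm] at hg hg'
      exact (Subgroup.mul_mem_cancel_left K hg).1 hg'
  rw [card_inducedEdges_eq_sum, Finset.sum_congr rfl fun x _ => this x, ← Finset.sum_filter,
    Finset.sum_const, smul_eq_mul, Set.ncard_eq_toFinset_card']
  congr 2
  ext; simp

/-- Right multiplication by a generator permutes `G`, so as many edges enter `S` as leave it: `S`
and its complement have equal boundaries. -/
theorem card_inducedEdges_compl [Fintype G] (P : GroupPresentation X G) (S : Finset G) :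
    (P.inducedEdges S).card + Nat.card X * Sᶜ.card =
      (P.inducedEdges Sᶜ).card + Nat.card X * S.card := by
  have := Fintype.ofFinite X
  have key : ∀ x, (S.filter fun g => g * P.gen x ∈ S).card + Sᶜ.card =
      (Sᶜ.filter fun g => g * P.gen x ∈ Sᶜ).card + S.card := by
    intro x
    have h1 : (S.filter fun g => g * P.gen x ∈ S).card +
        (Sᶜ.filter fun g => g * P.gen x ∈ S).card = S.card := by
      rw [← Finset.card_union_of_disjoint, ← Finset.filter_union, Finset.union_compl]
      · refine Finset.card_bij' (fun g _ => g * P.gen x) (fun g _ => g * (P.gen x)⁻¹) ?_ ?_ ?_ ?_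
          <;> simp
      · exact Finset.disjoint_filter_filter (disjoint_compl_right)
    have h2 := Finset.card_filter_add_card_filter_not (s := Sᶜ) (fun g => g * P.gen x ∈ S)
    simp only [Finset.mem_compl] at h2 ⊢
    omega
  rw [card_inducedEdges_eq_sum, card_inducedEdges_eq_sum, Nat.card_eq_fintype_card]
  have := Finset.sum_congr (rfl : (Finset.univ : Finset X) = Finset.univ) fun x _ => key x
  simpa [Finset.sum_add_distrib] using this

end Count

/-- `K` need not be generated by the generators that it contains; the subgroup that they generate is
the one to which minimality applies. -/
theorem finite_Gp_of_coe_eq (P : GroupPresentation X G) {S : Finset G} {K : Subgroup G}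
    (hK : (K : Set G) = S) :
    Finite (P.Gp {x | P.gen x ∈ K}) ∧ Nat.card (P.Gp {x | P.gen x ∈ K}) ≤ S.card := by
  have hle : P.Gp {x | P.gen x ∈ K} ≤ K := by
    rw [Gp, Subgroup.closure_le]
    rintro _ ⟨x, hx, rfl⟩
    exact hx
  have hcardK : Nat.card K = S.card := by
    rw [← Nat.card_eq_finsetCard]
    exact Nat.card_congr (Equiv.setCongr hK)
  have hKfin : Finite K := Set.finite_coe_iff.2 (hK ▸ S.finite_toSet)
  exact ⟨Finite.of_injective _ (Subgroup.inclusion_injective hle),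
    hcardK ▸ Subgroup.card_le_of_le hle⟩

theorem IsMinimal.two_pow_ncard_le_of_coe_eq [Finite X] (hP : P.IsMinimal) {S : Finset G}
    {K : Subgroup G} (hK : (K : Set G) = S) : 2 ^ {x | P.gen x ∈ K}.ncard ≤ S.card :=
  (hP.two_pow_ncard_le _ (P.finite_Gp_of_coe_eq hK).1).trans (P.finite_Gp_of_coe_eq hK).2

theorem ncard_lt_of_coe_eq [Finite X] (P : GroupPresentation X G) {S : Finset G} {K : Subgroup G}
    (hK : (K : Set G) = S) (hS : (S : Set G) ≠ Set.univ) :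
    {x | P.gen x ∈ K}.ncard < Nat.card X := by
  refine Set.ncard_lt_card fun h => hS ?_
  rw [← hK, P.eq_top_of_gen_mem (K := K) (Set.eq_univ_iff_forall.1 h), Subgroup.coe_top]

/-- The edge connectivity of the Cayley graph of a minimal presentation: at least `n` edges leave
a proper non-empty finite set of vertices. -/
theorem IsMinimal.card_inducedEdges_add_le [Finite X] (hP : P.IsMinimal) {S : Finset G}
    (hS : S.Nonempty) (hS' : (S : Set G) ≠ Set.univ) :
    (P.inducedEdges S).card + Nat.card X ≤ Nat.card X * S.card := by
  classical
  -- `b S` is the number of edges that start in `S` and end outside.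
  let b : Finset G → ℕ := fun S => Nat.card X * S.card - (P.inducedEdges S).card
  have hb : ∀ S, (P.inducedEdges S).card + b S = Nat.card X * S.card := fun S =>
    Nat.add_sub_cancel' (P.card_inducedEdges_le S)
  let 𝒮 : Set (Finset G) := {S | S.Nonempty ∧ (S : Set G) ≠ Set.univ}
  suffices h : ∀ S ∈ 𝒮, Nat.card X ≤ b S by
    have := h S ⟨hS, hS'⟩
    have := hb S
    omega
  -- First the boundary is minimized, then the size among the sets with minimal boundary.
  obtain ⟨S₀, hS₀, hmin₀⟩ := WellFounded.has_min (InvImage.wf b Nat.lt_wfRel.wf) 𝒮 ⟨S, hS, hS'⟩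
  have hmin : ∀ T ∈ 𝒮, b S₀ ≤ b T := fun T hT => not_lt.1 (hmin₀ T hT)
  suffices h : Nat.card X ≤ b S₀ from fun T hT => h.trans (hmin T hT)
  obtain ⟨S₁, ⟨hS₁, hb₁⟩, hmin₁⟩ := WellFounded.has_min
    (InvImage.wf Finset.card Nat.lt_wfRel.wf) {T | T ∈ 𝒮 ∧ b T = b S₀} ⟨S₀, hS₀, rfl⟩
  have hsmul : ∀ (g : G) (T : Finset G), T ∈ 𝒮 → g • T ∈ 𝒮 := by
    rintro g T ⟨h1, h2⟩
    refine ⟨h1.smul_finset, fun h => h2 ?_⟩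
    rw [Finset.coe_smul_finset] at h
    rw [← inv_smul_smul g (T : Set G), h, Set.smul_set_univ]
  have hbsmul : ∀ (g : G) (T : Finset G), b (g • T) = b T := fun g T => by
    simp only [b, Finset.card_smul_finset, P.card_inducedEdges_smul]
  obtain ⟨s, hs⟩ := hS₁.1
  obtain ⟨A, hA1, hA, hbA, hminA⟩ : ∃ A : Finset G, (1 : G) ∈ A ∧ A ∈ 𝒮 ∧ b A = b S₀ ∧
      ∀ T ∈ 𝒮, b T = b S₀ → A.card ≤ T.card := by
    refine ⟨s⁻¹ • S₁, Finset.inv_smul_mem_iff.1 (by simpa using hs), hsmul _ _ hS₁,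
      (hbsmul _ _).trans hb₁, fun T hT hbT => ?_⟩
    rw [Finset.card_smul_finset]
    exact not_lt.1 (hmin₁ T ⟨hT, hbT⟩)
  obtain ⟨K, hK⟩ : ∃ K : Subgroup G, (K : Set G) = A := by
    refine exists_subgroup_coe_eq hA1 fun g hg => ?_
    have hi : g • A ∩ A ∈ 𝒮 := ⟨hg, fun h => hA.2 (Set.eq_univ_of_univ_subset
      (h ▸ Finset.coe_subset.2 Finset.inter_subset_right))⟩
    have hcard := Finset.card_union_add_card_inter (g • A) A
    rw [Finset.card_smul_finset] at hcard
    have hu : g • A ∪ A ∈ 𝒮 := by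
      refine ⟨⟨1, Finset.mem_union_right _ hA1⟩, fun h => ?_⟩
      -- If the union were all of `G`, the complement of `A` would have the same boundary, hence at
      -- least |A| elements; two translates that overlap would then be too small to cover `G`.
      have hfin : Finite G := Set.finite_univ_iff.1 (h ▸ Finset.finite_toSet _)
      have := Fintype.ofFinite G
      have hc : Aᶜ ∈ 𝒮 := by
        refine ⟨?_, ?_⟩
        · rw [Finset.nonempty_iff_ne_empty, Ne, Finset.compl_eq_empty_iff]
          intro h'
          exact hA.2 (by simp [h'])
        · intro h'
          rw [Finset.coe_eq_univ, Finset.compl_eq_univ_iff] at h'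
          exact Finset.notMem_empty _ (h' ▸ hA1)
      have h1 := P.card_inducedEdges_compl A
      have h2 := hb A
      have h3 := hb Aᶜ
      have h4 := hminA _ hc (by omega)
      rw [Finset.coe_eq_univ.1 h, Finset.card_univ] at hcard
      rw [Finset.card_compl] at h4
      have := Finset.card_pos.2 hg
      have := Finset.card_le_univ A
      omega
    have h1 := hmin _ hi
    have h2 := hmin _ hu
    have h3 := P.card_inducedEdges_add_le (g • A) A
    rw [P.card_inducedEdges_smul] at h3
    have h4 := hb (g • A ∩ A)
    have h5 := hb (g • A ∪ A)
    have h6 := hb A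
    have h7 : Nat.card X * (g • A ∪ A).card + Nat.card X * (g • A ∩ A).card =
        Nat.card X * A.card + Nat.card X * A.card := by
      rw [← mul_add, hcard, mul_add]
    -- The boundaries of union and intersection sum to at most 2`b A`, and neither is below the
    -- minimum, so the intersection is minimal too.
    have h8 := hminA _ hi (by omega)
    have h9 : g • A ∩ A = A := Finset.eq_of_subset_of_card_le Finset.inter_subset_right h8
    exact (Finset.eq_of_subset_of_card_le (Finset.inter_eq_right.1 h9)
      (by rw [Finset.card_smul_finset])).symm
  have hE := P.card_inducedEdges_subgroup hK
  have hb' := hb A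
  set a := {x | P.gen x ∈ K}.ncard
  have h2 : 2 ^ a ≤ A.card := hP.two_pow_ncard_le_of_coe_eq hK
  have ha : a < Nat.card X := P.ncard_lt_of_coe_eq hK hA.2
  have h3 : a + 1 ≤ A.card := Nat.lt_two_pow_self.trans_le h2
  rw [← hbA]
  -- With n = a + c + 1 the boundary of `A` is (c + 1)|A| ≥ (c + 1)(a + 1) ≥ n.
  obtain ⟨c, hc⟩ := Nat.exists_eq_add_of_lt ha
  rw [hc] at hb' ⊢
  nlinarith

end GroupPresentation

end

/-! ### Sets with exactly n leaving edges -/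

section

open scoped Pointwise

namespace GroupPresentation

variable {X : Type u} {G : Type v} [Group G] {P : GroupPresentation X G}

theorem coe_finset_ne_univ {A : Type*} [Infinite A] (S : Finset A) : (S : Set A) ≠ Set.univ := fun h =>
  Set.infinite_univ (h ▸ S.finite_toSet)

theorem card_pos_of_nontrivial [Finite X] [Nontrivial G] (P : GroupPresentation X G) :
    0 < Nat.card X := by
  rw [Nat.pos_iff_ne_zero]
  intro h
  have : IsEmpty X := (Nat.card_eq_zero.1 h).resolve_right (fun h => h.not_finite ‹_›)
  have := P.eq_top_of_gen_mem (K := ⊥) (fun x => isEmptyElim x)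
  exact bot_ne_top this

section Degree

variable [Finite X] [DecidableEq G]

open Classical in
/-- The edges of a full subgraph at a vertex. -/
noncomputable def edgesAt (P : GroupPresentation X G) (S : Finset G) (v : G) : Finset (G × X) :=
  (P.inducedEdges S).filter fun e => e.1 = v ∨ e.1 * P.gen e.2 = v

theorem card_inducedEdges_erase (P : GroupPresentation X G) (S : Finset G) (v : G) :
    (P.inducedEdges (S.erase v)).card + (P.edgesAt S v).card = (P.inducedEdges S).card := by
  classical
  rw [← Finset.card_filter_add_card_filter_not (s := P.inducedEdges S)
    (fun e => e.1 = v ∨ e.1 * P.gen e.2 = v), add_comm, edgesAt]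
  congr 2
  ext e
  simp only [mem_inducedEdges, Finset.mem_erase, Finset.mem_filter]
  tauto

/-- In a minimal presentation, full subgraphs that meet in one vertex have together at most `2n`
edges at this vertex. -/
theorem IsMinimal.card_edgesAt_add_le (hP : P.IsMinimal) {A B : Finset G} {v : G}
    (h : A ∩ B = {v}) : (P.edgesAt A v).card + (P.edgesAt B v).card ≤ 2 * Nat.card X := by
  classical
  have := Fintype.ofFinite X
  rw [← Finset.card_union_of_disjoint]
  · have hsub : P.edgesAt A v ∪ P.edgesAt B v ⊆
        (Finset.univ.image fun x => (v, x)) ∪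
          (Finset.univ.image fun x => (v * (P.gen x)⁻¹, x)) := by
      rintro ⟨g, x⟩ he
      simp only [edgesAt, Finset.mem_union, Finset.mem_filter, Finset.mem_image, Finset.mem_univ,
        true_and, Prod.mk.injEq, exists_eq_right] at he ⊢
      rcases he with ⟨_, h | h⟩ | ⟨_, h | h⟩
      · exact Or.inl h.symm
      · exact Or.inr (by rw [← h, mul_inv_cancel_right])
      · exact Or.inl h.symm
      · exact Or.inr (by rw [← h, mul_inv_cancel_right])
    refine (Finset.card_le_card hsub).trans ((Finset.card_union_le _ _).trans ?_)
    rw [two_mul, Nat.card_eq_fintype_card]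
    exact add_le_add Finset.card_image_le Finset.card_image_le
  -- An edge counted on both sides would be a loop at `v`, and no generator is trivial.
  · rw [Finset.disjoint_left]
    rintro ⟨g, x⟩ h1 h2
    simp only [edgesAt, Finset.mem_filter, mem_inducedEdges] at h1 h2
    have h3 : g ∈ A ∩ B := Finset.mem_inter.2 ⟨h1.1.1, h2.1.1⟩
    have h4 : g * P.gen x ∈ A ∩ B := Finset.mem_inter.2 ⟨h1.1.2, h2.1.2⟩
    rw [h, Finset.mem_singleton] at h3 h4
    rw [← h3] at h4
    exact hP.gen_ne_one x (by simpa using h4)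

end Degree

/-- A pair of vertices spans at most two edges, and two only for a generator of order `2`. -/
theorem IsMinimal.card_inducedEdges_pair [Finite X] [DecidableEq G] (hP : P.IsMinimal) {y : G}
    (hy : y ≠ 1) : (P.inducedEdges {1, y}).card ≤ 1 ∨
      (P.inducedEdges {1, y}).card = 2 ∧ ∃ x, orderOf (P.gen x) = 2 := by
  classical
  by_cases hx : ∃ x, P.gen x = y
  · obtain ⟨x, rfl⟩ := hx
    by_cases h2 : P.gen x = (P.gen x)⁻¹
    · right
      constructor
      · have : P.inducedEdges {1, P.gen x} = {(1, x), (P.gen x, x)} := by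
          ext ⟨g, z⟩
          simp only [mem_inducedEdges, Finset.mem_insert, Finset.mem_singleton, Prod.mk.injEq]
          constructor
          · rintro ⟨rfl | rfl, h⟩
            · rw [one_mul] at h
              exact Or.inl ⟨rfl, hP.gen_injective (h.resolve_left (hP.gen_ne_one z))⟩
            · refine Or.inr ⟨rfl, hP.gen_injective ?_⟩
              rcases h with h | h
              · rw [eq_inv_of_mul_eq_one_right h, ← h2]
              · exact absurd (mul_eq_left.1 h) (hP.gen_ne_one z)
          · rintro (⟨rfl, rfl⟩ | ⟨rfl, rfl⟩)
            · simp
            · simp [mul_eq_one_iff_eq_inv.2 h2]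
        rw [this, Finset.card_pair]
        simp [hy.symm]
      · exact ⟨x, orderOf_eq_prime (by rw [sq]; exact mul_eq_one_iff_eq_inv.2 h2) hy⟩
    · left
      refine (Finset.card_le_card (t := {(1, x)}) ?_).trans (by simp)
      rintro ⟨g, z⟩ h
      simp only [mem_inducedEdges, Finset.mem_insert, Finset.mem_singleton, Prod.mk.injEq] at h ⊢
      obtain ⟨rfl | rfl, h⟩ := h
      · rw [one_mul] at h
        exact ⟨rfl, hP.gen_injective (h.resolve_left (hP.gen_ne_one z))⟩
      · exfalso
        rcases h with h | h
        -- An edge back from `y` to 1 would be labeled by x⁻¹; minimality leaves only `x` itself,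
        -- which is not an involution here.
        · have hz := eq_inv_of_mul_eq_one_right h
          refine hP.gen_notMem_Gp (Y := {x}) (x := z) ?_ ?_
          · rintro rfl
            exact h2 hz
          · rw [hz]
            exact inv_mem (P.gen_mem_Gp rfl)
        · exact hP.gen_ne_one z (mul_eq_left.1 h)
  -- If `y` is not a generator, the only possible edge runs from `y` to 1, with label `y⁻¹`.
  · left
    rw [Finset.card_le_one]
    rintro ⟨g, z⟩ h ⟨g', z'⟩ h'
    simp only [mem_inducedEdges, Finset.mem_insert, Finset.mem_singleton] at h h'
    have key : ∀ (g : G) (z : X), (g = 1 ∨ g = y) ∧ (g * P.gen z = 1 ∨ g * P.gen z = y) →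
        g = y ∧ P.gen z = y⁻¹ := by
      rintro g z ⟨rfl | rfl, h⟩
      · rw [one_mul] at h
        exact absurd ⟨z, h.resolve_left (hP.gen_ne_one z)⟩ hx
      · rcases h with h | h
        · exact ⟨rfl, eq_inv_of_mul_eq_one_right h⟩
        · exact absurd (mul_eq_left.1 h) (hP.gen_ne_one z)
    obtain ⟨rfl, h1⟩ := key _ _ h
    obtain ⟨rfl, h2⟩ := key _ _ h'
    rw [Prod.mk.injEq]
    exact ⟨rfl, hP.gen_injective (h1.trans h2.symm)⟩

/-- Only single vertices have exactly `n` leaving edges, with two exceptions. -/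
theorem IsMinimal.eq_one_or_eq_two [Finite X] [Infinite G] (hP : P.IsMinimal) {S : Finset G}
    (hS : 2 ≤ S.card) (hSE : (P.inducedEdges S).card + Nat.card X = Nat.card X * S.card) :
    Nat.card X = 1 ∨ (Nat.card X = 2 ∧ ∃ x, orderOf (P.gen x) = 2) := by
  classical
  have hpos := P.card_pos_of_nontrivial
  obtain ⟨S₁, ⟨hS₁, hE₁⟩, hmin₁⟩ := WellFounded.has_min
    (InvImage.wf Finset.card Nat.lt_wfRel.wf)
    {T : Finset G | 2 ≤ T.card ∧ (P.inducedEdges T).card + Nat.card X = Nat.card X * T.card}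
    ⟨S, hS, hSE⟩
  obtain ⟨s, hs⟩ := Finset.card_pos.1 (zero_lt_two.trans_le hS₁)
  obtain ⟨A, hA1, hA2, hAE, hmin⟩ : ∃ A : Finset G, (1 : G) ∈ A ∧ 2 ≤ A.card ∧
      (P.inducedEdges A).card + Nat.card X = Nat.card X * A.card ∧
      ∀ T : Finset G, 2 ≤ T.card →
        (P.inducedEdges T).card + Nat.card X = Nat.card X * T.card → A.card ≤ T.card := by
    refine ⟨s⁻¹ • S₁, Finset.inv_smul_mem_iff.1 (by simpa using hs), ?_, ?_, fun T hT hbT => ?_⟩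
    · rwa [Finset.card_smul_finset]
    · rwa [Finset.card_smul_finset, P.card_inducedEdges_smul]
    · rw [Finset.card_smul_finset]
      exact not_lt.1 (hmin₁ T ⟨hT, hbT⟩)
  have hle : ∀ T : Finset G, T.Nonempty →
      (P.inducedEdges T).card + Nat.card X ≤ Nat.card X * T.card := fun T hT =>
    hP.card_inducedEdges_add_le hT (coe_finset_ne_univ T)
  rcases hA2.eq_or_lt with hA2' | hA3
  · obtain ⟨y, hy, rfl⟩ : ∃ y, y ≠ 1 ∧ A = {1, y} := by
      obtain ⟨a, b, hab, rfl⟩ := Finset.card_eq_two.1 hA2'.symm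
      rcases Finset.mem_insert.1 hA1 with rfl | h
      · exact ⟨b, hab.symm, rfl⟩
      · rw [Finset.mem_singleton] at h
        subst h
        exact ⟨a, hab, Finset.pair_comm _ _⟩
    rw [Finset.card_pair hy.symm] at hAE
    rcases hP.card_inducedEdges_pair hy with h | ⟨h, hx⟩
    · left; omega
    · right
      exact ⟨by omega, hx⟩
  · exfalso
    -- Removing a vertex leaves at least two vertices but, by minimality of the size, not exactly n
    -- leaving edges. So more than n edges are lost at every vertex.
    have hdeg : ∀ B : Finset G, B.card = A.card →
        (P.inducedEdges B).card + Nat.card X = Nat.card X * B.card → ∀ v ∈ B,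
        Nat.card X < (P.edgesAt B v).card := by
      intro B hB hBE v hv
      have h1 := P.card_inducedEdges_erase B v
      have h2 := Finset.card_erase_of_mem hv
      have h3 := hle (B.erase v) (Finset.card_pos.1 (by omega))
      have h4 : (P.inducedEdges (B.erase v)).card + Nat.card X ≠
          Nat.card X * (B.erase v).card := fun h => by
        have := hmin _ (by omega) h
        omega
      have h5 : Nat.card X * B.card = Nat.card X * (B.erase v).card + Nat.card X := by
        rw [h2, ← Nat.mul_succ]
        congr 1
        omega
      omega
    obtain ⟨K, hK⟩ : ∃ K : Subgroup G, (K : Set G) = A := by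
      refine exists_subgroup_coe_eq hA1 fun g hg => ?_
      have hcard := Finset.card_union_add_card_inter (g • A) A
      rw [Finset.card_smul_finset] at hcard
      have h1 := hle _ hg
      have h2 := hle (g • A ∪ A) ⟨1, Finset.mem_union_right _ hA1⟩
      have h3 := P.card_inducedEdges_add_le (g • A) A
      rw [P.card_inducedEdges_smul] at h3
      have h7 : Nat.card X * (g • A ∪ A).card + Nat.card X * (g • A ∩ A).card =
          Nat.card X * A.card + Nat.card X * A.card := by
        rw [← mul_add, hcard, mul_add]
      rcases Nat.lt_or_ge (g • A ∩ A).card 2 with hlt | hge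
      -- Two such sets meeting in one vertex would have more than 2n edges there.
      · exfalso
        have hpos := Finset.card_pos.2 hg
        obtain ⟨v, hv⟩ := Finset.card_eq_one.1 (by omega : (g • A ∩ A).card = 1)
        have hv' : v ∈ g • A ∩ A := hv ▸ Finset.mem_singleton_self v
        have h4 := hP.card_edgesAt_add_le hv
        have h5 := hdeg (g • A) (Finset.card_smul_finset _ _)
          (by rw [Finset.card_smul_finset, P.card_inducedEdges_smul, hAE]) v
          (Finset.mem_inter.1 hv').1
        have h6 := hdeg A rfl hAE v (Finset.mem_inter.1 hv').2
        omega
      · have h8 := hmin _ hge (by omega)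
        have h9 : g • A ∩ A = A := Finset.eq_of_subset_of_card_le Finset.inter_subset_right h8
        exact (Finset.eq_of_subset_of_card_le (Finset.inter_eq_right.1 h9)
          (by rw [Finset.card_smul_finset])).symm
    have hE := P.card_inducedEdges_subgroup hK
    have h2 := hP.two_pow_ncard_le_of_coe_eq hK
    have ha := P.ncard_lt_of_coe_eq hK (coe_finset_ne_univ A)
    set a := {x | P.gen x ∈ K}.ncard
    -- This uses |A| ≥ 3 for a ≤ 1 and |A| ≥ 2^a otherwise. With n = a + c + 1 the boundary (c +
    -- 1)|A| then exceeds n.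
    have h3 : a + 2 ≤ A.card := by
      rcases Nat.lt_or_ge a 2 with h | h
      · omega
      · have hpow : ∀ k, 2 ≤ k → k + 2 ≤ 2 ^ k := fun k hk => by
          induction k, hk using Nat.le_induction with
          | base => norm_num
          | succ k hk ih =>
            rw [pow_succ]
            omega
        exact (hpow a h).trans h2
    obtain ⟨c, hc⟩ := Nat.exists_eq_add_of_lt ha
    rw [hc, hE] at hAE
    nlinarith

end GroupPresentation

end

/-! ### Amenability and Følner sets -/

section

open scoped Pointwise ENNReal ComplexOrder
open Filter Topology

namespace GroupPresentation

variable {X : Type u} {G : Type v} [Group G] {P : GroupPresentation X G}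

/-- A bounded function as an element of `ℓ^∞`. -/
def boundedFunction {ι : Type*} (f : ι → ℂ) (C : ℝ) (hf : ∀ i, ‖f i‖ ≤ C) :
    lp (fun _ : ι => ℂ) ∞ :=
  ⟨f, memℓp_infty ⟨C, by rintro _ ⟨i, rfl⟩; exact hf i⟩⟩

open Classical in
/-- Indicator functions as elements of `ℓ^∞`. -/
noncomputable def indicatorFunction {ι : Type*} (s : Set ι) : lp (fun _ : ι => ℂ) ∞ :=
  boundedFunction (fun i => if i ∈ s then 1 else 0) 1 fun i => by split_ifs <;> simp

theorem indicatorFunction_apply {ι : Type*} (s : Set ι) [DecidablePred (· ∈ s)] (i : ι) :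
    indicatorFunction s i = if i ∈ s then 1 else 0 := by
  change @ite ℂ (i ∈ s) (Classical.propDecidable _) 1 0 = _
  congr

/-- An amenable group has no paradoxical map: no injective map `G × {0,1} → G` moves every element
within a finite set of translations. -/
theorem not_amenable_of_injective (hG : IsAmenableGroup G) (W : Finset G) (f : G × Bool → G)
    (hf : Function.Injective f) (hW : ∀ g i, ∃ w ∈ W, f (g, i) = g * w) : False := by
  classical
  obtain ⟨m, hm1, hmpos, hminv⟩ := hG
  -- The inverses convert moves by right multiplication into left translations: `B p` is the
  -- translate of `A p` by `p.2`. The `A p` sum to 2, while injectivity of `f` makes the sum of the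
  -- `B p` at most 1.
  let A : Bool × G → lp (fun _ : G => ℂ) ∞ := fun p =>
    indicatorFunction {g | f (g⁻¹, p.1) = g⁻¹ * p.2}
  let B : Bool × G → lp (fun _ : G => ℂ) ∞ := fun p =>
    indicatorFunction {g | f ((p.2 * g)⁻¹, p.1) = g⁻¹}
  have hAB : ∀ p, m (B p) = m (A p) := by
    intro p
    refine hminv p.2 _ _ fun g => ?_
    rw [indicatorFunction_apply, indicatorFunction_apply]
    simp
  have hA : ∑ p ∈ Finset.univ ×ˢ W, A p = (2 : ℂ) • (1 : lp (fun _ : G => ℂ) ∞) := by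
    ext g
    rw [lp.coeFn_sum, Finset.sum_apply, Finset.sum_product]
    have : ∀ i : Bool, ∑ w ∈ W, A (i, w) g = 1 := by
      intro i
      obtain ⟨w, hw, hfw⟩ := hW g⁻¹ i
      rw [Finset.sum_eq_single_of_mem w hw]
      · exact (indicatorFunction_apply _ _).trans (if_pos hfw)
      · intro w' _ hne
        refine (indicatorFunction_apply _ _).trans (if_neg fun h => ?_)
        exact hne (mul_left_cancel (h.symm.trans hfw))
    rw [Finset.sum_congr rfl fun i _ => this i]
    simp
  have hB : ∀ g, 0 ≤ ((1 : lp (fun _ : G => ℂ) ∞) - ∑ p ∈ Finset.univ ×ˢ W, B p) g := by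
    intro g
    rw [lp.coeFn_sub, Pi.sub_apply, lp.coeFn_sum, Finset.sum_apply]
    have h1 : ∀ p, B p g = if f ((p.2 * g)⁻¹, p.1) = g⁻¹ then 1 else 0 := fun p =>
      indicatorFunction_apply _ _
    have h2 : ((Finset.univ ×ˢ W).filter
        fun p : Bool × G => f ((p.2 * g)⁻¹, p.1) = g⁻¹).card ≤ 1 := by
      rw [Finset.card_le_one]
      intro p hp q hq
      have h := hf ((Finset.mem_filter.1 hp).2.trans (Finset.mem_filter.1 hq).2.symm)
      rw [Prod.mk.injEq, inv_inj, mul_left_inj] at h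
      exact Prod.ext h.2 h.1
    rw [Finset.sum_congr rfl fun p _ => h1 p, Finset.sum_boole, sub_nonneg]
    change _ ≤ (1 : ℂ)
    exact_mod_cast h2
  have h := hmpos _ hB
  rw [map_sub, map_sum, Finset.sum_congr rfl fun p _ => hAB p, ← map_sum, hA, map_smul, hm1] at h
  rw [smul_eq_mul, mul_one] at h
  have := (Complex.le_def.1 h).1
  norm_num at this

section Folner

variable [Finite X]

/-- Without Følner sets, multiplication by a finite set enlarges all finite sets by a fixed factor;
a power of it doubles them, and Hall's theorem yields a paradoxical map. -/
theorem exists_folner_of_amenable (P : GroupPresentation X G) (hG : IsAmenableGroup G) {ε : ℝ}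
    (hε : 0 < ε) :
    ∃ S : Finset G, S.Nonempty ∧
      (Nat.card X : ℝ) * S.card - (P.inducedEdges S).card < ε * S.card := by
  classical
  have := Fintype.ofFinite X
  by_contra! hcon
  let U : Finset G := insert 1 (Finset.univ.image P.gen)
  -- Each generator moves at most |SU ∖ S| elements out of `S`, so ε|S| ≤ n|SU ∖ S|; n + 1 keeps the
  -- denominator positive.
  have hgrow : ∀ S : Finset G, (1 + ε / (Nat.card X + 1)) * S.card ≤ ((S * U).card : ℝ) := by
    intro S
    rcases S.eq_empty_or_nonempty with rfl | hS
    · simp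
    have hsub : S ⊆ S * U := fun g hg =>
      Finset.mem_mul.2 ⟨g, hg, 1, Finset.mem_insert_self _ _, mul_one g⟩
    have hx : ∀ x, (S.filter fun g => g * P.gen x ∉ S).card ≤ ((S * U) \ S).card := by
      intro x
      refine Finset.card_le_card_of_injOn (fun g => g * P.gen x) ?_
        (fun a _ b _ h => mul_right_cancel h)
      intro g hg
      have hg := Finset.mem_filter.1 hg
      exact Finset.mem_sdiff.2 ⟨Finset.mul_mem_mul hg.1 (by simp [U]), hg.2⟩
    have hsum : Nat.card X * S.card ≤
        (P.inducedEdges S).card + Nat.card X * ((S * U) \ S).card := by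
      have h1 : ∀ x, S.card ≤ (S.filter fun g => g * P.gen x ∈ S).card + ((S * U) \ S).card := by
        intro x
        rw [← Finset.card_filter_add_card_filter_not (s := S) (fun g => g * P.gen x ∈ S)]
        exact Nat.add_le_add_left (hx x) _
      have h2 := Finset.sum_le_sum fun x (_ : x ∈ Finset.univ) => h1 x
      rw [Finset.sum_add_distrib, ← card_inducedEdges_eq_sum] at h2
      simpa [Nat.card_eq_fintype_card] using h2
    have h3 := hcon S hS
    have h4 : ((S * U).card : ℝ) = S.card + ((S * U) \ S).card := by
      rw [add_comm]
      exact_mod_cast (Finset.card_sdiff_add_card_eq_card hsub).symm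
    have h5 : (Nat.card X : ℝ) * S.card ≤
        (P.inducedEdges S).card + Nat.card X * ((S * U) \ S).card := by exact_mod_cast hsum
    rw [h4, add_mul, one_mul, add_le_add_iff_left, div_mul_eq_mul_div, div_le_iff₀ (by positivity)]
    have : (0 : ℝ) ≤ ((S * U) \ S).card := by positivity
    nlinarith
  have hpow : ∀ (k : ℕ) (S : Finset G),
      (1 + ε / (Nat.card X + 1)) ^ k * S.card ≤ ((S * U ^ k).card : ℝ) := by
    intro k S
    induction k with
    | zero => simp
    | succ k ih =>
      rw [pow_succ, pow_succ, ← mul_assoc]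
      refine le_trans ?_ (hgrow _)
      rw [mul_comm _ (1 + ε / (Nat.card X + 1)), mul_assoc]
      exact mul_le_mul_of_nonneg_left ih (by positivity)
  have hr : 1 < 1 + ε / ((Nat.card X : ℝ) + 1) := lt_add_of_pos_right _ (by positivity)
  obtain ⟨k, hk⟩ := pow_unbounded_of_one_lt (2 : ℝ) hr
  obtain ⟨f, hf, hfW⟩ := (Finset.all_card_le_biUnion_card_iff_exists_injective
    (fun p : G × Bool => p.1 • U ^ k)).1 fun s => by
      have h1 : s.card ≤ 2 * (s.image Prod.fst).card := by
        have : s ⊆ s.image Prod.fst ×ˢ Finset.univ := fun p hp =>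
          Finset.mem_product.2 ⟨Finset.mem_image_of_mem _ hp, Finset.mem_univ _⟩
        have := Finset.card_le_card this
        rw [Finset.card_product, Finset.card_univ, Fintype.card_bool] at this
        omega
      have h2 : 2 * (s.image Prod.fst).card ≤ (s.image Prod.fst * U ^ k).card := by
        have := hpow k (s.image Prod.fst)
        have h3 : (2 : ℝ) * (s.image Prod.fst).card ≤ (s.image Prod.fst * U ^ k).card :=
          (mul_le_mul_of_nonneg_right hk.le (by positivity)).trans this
        exact_mod_cast h3
      refine (h1.trans h2).trans (Finset.card_le_card ?_)
      intro g hg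
      obtain ⟨a, ha, b, hb, rfl⟩ := Finset.mem_mul.1 hg
      obtain ⟨p, hp, rfl⟩ := Finset.mem_image.1 ha
      exact Finset.mem_biUnion.2 ⟨p, hp, Finset.smul_mem_smul_finset hb⟩
  refine not_amenable_of_injective hG (U ^ k) f hf fun g i => ?_
  obtain ⟨w, hw, h⟩ := Finset.mem_smul_finset.1 (hfW (g, i))
  exact ⟨w, hw, h.symm⟩

/-- The sums run over Sx and over S. The two difference sets have equal size, at most the number of
edges leaving `S`. -/
theorem norm_sum_sub_sum_le (P : GroupPresentation X G) (S : Finset G) (x : X) (φ : G → ℂ) {C : ℝ}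
    (hφ : ∀ g, ‖φ g‖ ≤ C) :
    ‖∑ g ∈ S, φ (g * P.gen x) - ∑ g ∈ S, φ g‖ ≤
      2 * C * (Nat.card X * S.card - (P.inducedEdges S).card) := by
  classical
  have := Fintype.ofFinite X
  have hC : 0 ≤ C := (norm_nonneg _).trans (hφ 1)
  let T := S.image fun g => g * P.gen x
  have hT : ∑ g ∈ S, φ (g * P.gen x) = ∑ g ∈ T, φ g :=
    (Finset.sum_image fun a _ b _ h => mul_right_cancel h).symm
  have hTc : T.card = S.card := Finset.card_image_of_injective _ fun a b h => mul_right_cancel h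
  have hd : (T \ S).card + (P.inducedEdges S).card ≤ Nat.card X * S.card := by
    have h1 : (T \ S).card ≤ (S.filter fun g => g * P.gen x ∉ S).card := by
      refine (Finset.card_le_card ?_).trans
        (Finset.card_image_le (f := fun g => g * P.gen x))
      intro g hg
      obtain ⟨h1, h2⟩ := Finset.mem_sdiff.1 hg
      obtain ⟨a, ha, rfl⟩ := Finset.mem_image.1 h1
      exact Finset.mem_image_of_mem _ (Finset.mem_filter.2 ⟨ha, h2⟩)
    have h2 : ∑ y, (S.filter fun g => g * P.gen y ∉ S).card + (P.inducedEdges S).card =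
        Nat.card X * S.card := by
      rw [card_inducedEdges_eq_sum, ← Finset.sum_add_distrib, Finset.sum_congr rfl fun y _ =>
        (add_comm _ _).trans
          (Finset.card_filter_add_card_filter_not (s := S) (fun g => g * P.gen y ∈ S))]
      simp [Nat.card_eq_fintype_card]
    have h3 := Finset.single_le_sum (f := fun y => (S.filter fun g => g * P.gen y ∉ S).card)
      (fun y _ => Nat.zero_le _) (Finset.mem_univ x)
    omega
  have hd' : (S \ T).card = (T \ S).card := Finset.card_sdiff_comm hTc.symm
  have hd'' : ((T \ S).card : ℝ) ≤ Nat.card X * S.card - (P.inducedEdges S).card := by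
    rw [le_sub_iff_add_le]
    exact_mod_cast hd
  rw [hT, ← Finset.sum_sdiff_sub_sum_sdiff]
  have hb : ∀ s : Finset G, ‖∑ g ∈ s, φ g‖ ≤ s.card * C := fun s => by
    refine (norm_sum_le_of_le s fun g _ => hφ g).trans ?_
    simp
  refine (norm_sub_le _ _).trans ((add_le_add (hb _) (hb _)).trans ?_)
  rw [hd']
  nlinarith

/-- The mean is an ultralimit of averages over the inverses of Følner sets: these sets are almost
invariant on the right, and the mean must be invariant on the left. -/
theorem amenable_of_folner (P : GroupPresentation X G)
    (h : ∀ ε : ℝ, 0 < ε → ∃ S : Finset G, S.Nonempty ∧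
      (Nat.card X : ℝ) * S.card - (P.inducedEdges S).card < ε * S.card) :
    IsAmenableGroup G := by
  classical
  choose S hS hSE using fun k : ℕ => h (1 / ((k : ℝ) + 1)) (by positivity)
  have hpos : ∀ k, (0 : ℝ) < (S k).card := fun k => by exact_mod_cast Finset.card_pos.2 (hS k)
  let avg : lp (fun _ : G => ℂ) ∞ → ℕ → ℂ := fun f k =>
    ((S k).card : ℂ)⁻¹ * ∑ g ∈ S k, f g⁻¹
  have hbound : ∀ (f : lp (fun _ : G => ℂ) ∞) g, ‖f g‖ ≤ ‖f‖ := fun f g =>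
    lp.norm_apply_le_norm (by simp) f g
  have havg : ∀ f k, ‖avg f k‖ ≤ ‖f‖ := by
    intro f k
    rw [norm_mul, norm_inv, Complex.norm_natCast, inv_mul_le_iff₀ (hpos k)]
    refine (norm_sum_le_of_le (S k) fun g _ => hbound f g⁻¹).trans ?_
    simp
  let 𝒰 : Ultrafilter ℕ := hyperfilter ℕ
  have hlim : ∀ f, ∃ z, Tendsto (avg f) 𝒰 (𝓝 z) := by
    intro f
    obtain ⟨z, -, hz⟩ := (isCompact_closedBall (0 : ℂ) ‖f‖).ultrafilter_le_nhds
      (𝒰.map (avg f)) (by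
        rw [le_principal_iff]
        exact Filter.mem_map.2 (Filter.univ_mem' fun k => by simpa using havg f k))
    exact ⟨z, hz⟩
  choose m hm using hlim
  have h𝒰 : (𝒰 : Filter ℕ) ≤ atTop := by
    rw [← Nat.cofinite_eq_atTop]
    exact hyperfilter_le_cofinite
  have huniq : ∀ {f : lp (fun _ : G => ℂ) ∞} {z : ℂ}, Tendsto (avg f) 𝒰 (𝓝 z) → m f = z :=
    fun hz => tendsto_nhds_unique (hm _) hz
  let M : lp (fun _ : G => ℂ) ∞ →ₗ[ℂ] ℂ :=
    { toFun := m
      map_add' := fun f f' => huniq <| by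
        refine ((hm f).add (hm f')).congr fun k => ?_
        simp only [avg, ← mul_add, ← Finset.sum_add_distrib]
        rfl
      map_smul' := fun c f => huniq <| by
        refine ((hm f).const_mul c).congr fun k => ?_
        simp only [avg, mul_left_comm c, Finset.mul_sum]
        rfl }
  refine ⟨M, ?_, ?_, ?_⟩
  · refine huniq (tendsto_const_nhds.congr fun k => ?_)
    have : ∑ g ∈ S k, (1 : lp (fun _ : G => ℂ) ∞) g⁻¹ = ((S k).card : ℂ) := by
      rw [Finset.sum_congr rfl fun g _ => show (1 : lp (fun _ : G => ℂ) ∞) g⁻¹ = 1 from rfl]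
      simp
    change 1 = _ * _
    rw [this, inv_mul_cancel₀]
    exact_mod_cast (hpos k).ne'
  · intro f hf
    refine ge_of_tendsto' (hm f) fun k => ?_
    refine mul_nonneg ?_ (Finset.sum_nonneg fun g _ => hf _)
    rw [← Complex.ofReal_natCast, ← Complex.ofReal_inv]
    exact_mod_cast (inv_pos.2 (hpos k)).le
  -- The translations that preserve the mean form a subgroup, so generators suffice.
  · let N : Subgroup G :=
      { carrier := {a | ∀ f f' : lp (fun _ : G => ℂ) ∞, (∀ g, f' g = f (a * g)) → m f' = m f}
        one_mem' := fun f f' h => by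
          congr 1
          ext g
          rw [h, one_mul]
        mul_mem' := fun {a b} ha hb f f' h => by
          rw [← ha f (boundedFunction (fun g => f (a * g)) ‖f‖ fun g => hbound f _) fun g => rfl]
          refine hb _ _ fun g => ?_
          rw [h, mul_assoc]
          rfl
        inv_mem' := fun {a} ha f f' h => by
          refine (ha f' f fun g => ?_).symm
          rw [h, inv_mul_cancel_left] }
    have hN : N = ⊤ := by
      refine P.eq_top_of_gen_mem fun x => ?_
      rw [← inv_mem_iff]
      -- Invariance is checked for the inverse of the generator, since f(x⁻¹g⁻¹) = f((gx)⁻¹) shifts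
      -- the summation variable on the right.
      intro f f' h
      refine huniq ?_
      have h0 : Tendsto (fun k => avg f' k - avg f k) 𝒰 (𝓝 0) := by
        refine Tendsto.mono_left ?_ h𝒰
        refine squeeze_zero_norm (a := fun k : ℕ => 2 * ‖f‖ * (1 / ((k : ℝ) + 1))) (fun k => ?_) ?_
        · have h1 := P.norm_sum_sub_sum_le (S k) x (fun g => f g⁻¹) (fun g => hbound f _)
          have h2 : avg f' k - avg f k = ((S k).card : ℂ)⁻¹ *
              (∑ g ∈ S k, f (g * P.gen x)⁻¹ - ∑ g ∈ S k, f g⁻¹) := by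
            simp only [avg, ← mul_sub]
            congr 2
            refine Finset.sum_congr rfl fun g _ => ?_
            rw [h, mul_inv_rev]
          rw [h2, norm_mul, norm_inv, Complex.norm_natCast, inv_mul_le_iff₀ (hpos k)]
          refine h1.trans ?_
          have h3 := mul_le_mul_of_nonneg_left (hSE k).le
            (mul_nonneg zero_le_two (norm_nonneg f))
          linarith
        · simpa using tendsto_one_div_add_atTop_nhds_zero_nat.const_mul (2 * ‖f‖)
      simpa using h0.add (hm f)
    intro a
    exact (hN ▸ Subgroup.mem_top a : a ∈ N)

end Folner

end GroupPresentation

end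

/-! ### Residual finiteness, the Hopf property, and forests as Cayley graphs of free bases -/

open Classical in
/-- Free groups are residually finite. -/
theorem exists_finite_hom_ne_one {X : Type u} {w : FreeGroup X} (hw : w ≠ 1) :
    ∃ (Q : Type u) (_ : Group Q) (_ : Finite Q) (φ : FreeGroup X →* Q), φ w ≠ 1 := by
  -- The suffixes of the reduced word of `w`. Left multiplication by a letter is a partial injection
  -- of this finite set and extends to a permutation; reading the word then carries 1 to `w`.
  let W : Finset (FreeGroup X) := (w.toWord.tails.map FreeGroup.mk).toFinset
  have hW : ∀ t, t <:+ w.toWord → FreeGroup.mk t ∈ W := fun t ht => by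
    simp only [W, List.mem_toFinset, List.mem_map, List.mem_tails]
    exact ⟨t, ht, rfl⟩
  let e : ∀ x : X, {u : W // FreeGroup.of x * u.1 ∈ W} ≃ {u : W // (FreeGroup.of x)⁻¹ * u.1 ∈ W} :=
    fun x =>
    { toFun := fun u => ⟨⟨FreeGroup.of x * u.1.1, u.2⟩, by simp⟩
      invFun := fun u => ⟨⟨(FreeGroup.of x)⁻¹ * u.1.1, u.2⟩, by simp⟩
      left_inv := fun u => by simp
      right_inv := fun u => by simp }
  let σ : X → Equiv.Perm W := fun x => (e x).extendSubtype
  have hσ : ∀ x (u : W) (h : FreeGroup.of x * u.1 ∈ W), σ x u = ⟨FreeGroup.of x * u.1, h⟩ :=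
    fun x u h => Equiv.extendSubtype_apply_of_mem (e x) u h
  let φ : FreeGroup X →* Equiv.Perm W := FreeGroup.lift σ
  have h1 : (1 : FreeGroup X) ∈ W := hW [] (List.nil_suffix)
  have key : ∀ t (ht : t <:+ w.toWord), φ (FreeGroup.mk t) ⟨1, h1⟩ = ⟨FreeGroup.mk t, hW t ht⟩ := by
    intro t
    induction t with
    | nil => intro _; rfl
    | cons a t ih =>
      intro ht
      have ht' : t <:+ w.toWord := (List.suffix_cons a t).trans ht
      obtain ⟨x, b⟩ := a
      have hmem := hW _ ht
      cases b with
      | true =>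
        have h2 : FreeGroup.mk ((x, true) :: t) = FreeGroup.of x * FreeGroup.mk t := rfl
        simp only [h2] at hmem ⊢
        rw [map_mul, Equiv.Perm.mul_apply, ih ht', FreeGroup.lift_apply_of, hσ x _ hmem]
      | false =>
        have h2 : FreeGroup.mk ((x, false) :: t) = (FreeGroup.of x)⁻¹ * FreeGroup.mk t := rfl
        simp only [h2] at hmem ⊢
        rw [map_mul, Equiv.Perm.mul_apply, ih ht', map_inv, FreeGroup.lift_apply_of,
          Equiv.Perm.inv_eq_iff_eq, hσ x ⟨_, hmem⟩ (by simpa using hW t ht')]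
        simp
  refine ⟨Equiv.Perm W, inferInstance, inferInstance, φ, fun h => hw ?_⟩
  have h2 := key w.toWord (List.suffix_refl _)
  have h3 : FreeGroup.mk w.toWord = 1 := by
    rw [← FreeGroup.mk_toWord (x := w)] at h
    rw [h] at h2
    exact (congrArg Subtype.val h2).symm
  rwa [FreeGroup.mk_toWord] at h3

/-- Finitely generated free groups are Hopfian. -/
theorem FreeGroup.injective_of_surjective_endomorphism {X : Type u} [Finite X]
    (f : FreeGroup X →* FreeGroup X) (hf : Function.Surjective f) : Function.Injective f := by
  rw [injective_iff_map_eq_one]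
  intro w hw
  by_contra hne
  obtain ⟨Q, _, _, φ, hφ⟩ := exists_finite_hom_ne_one hne
  -- Composition with `f` is injective on this finite set of homomorphisms, hence surjective, so `φ`
  -- factors through `f` and kills `w`.
  have : Finite (FreeGroup X →* Q) := Finite.of_equiv _ FreeGroup.lift
  have hinj : Function.Injective fun ψ : FreeGroup X →* Q => ψ.comp f := fun ψ ψ' h =>
    (MonoidHom.cancel_right hf).1 h
  obtain ⟨ψ, hψ⟩ := Finite.surjective_of_injective hinj φ
  apply hφ
  rw [← hψ]
  simp [hw]

namespace GroupPresentation

variable {X : Type u} {G : Type v} [Group G] {P : GroupPresentation X G}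

/-- Composed with an isomorphism of `G` with the free group on `X`, the lift becomes a surjective
endomorphism, to which the Hopf property applies. -/
theorem injective_lift_of_freeGroup [Finite X] (P : GroupPresentation X G) {n : ℕ}
    (hn : Nat.card X = n) (e : G ≃* FreeGroup (Fin n)) :
    Function.Injective (FreeGroup.lift P.gen) := by
  let e' : FreeGroup (Fin n) ≃* FreeGroup X :=
    FreeGroup.freeGroupCongr (Finite.equivFinOfCardEq hn).symm
  let f : FreeGroup X →* FreeGroup X :=
    (e'.toMonoidHom.comp e.toMonoidHom).comp (FreeGroup.lift P.gen)
  have hf : Function.Surjective f :=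
    (e'.surjective.comp e.surjective).comp P.surjective_lift
  have := FreeGroup.injective_of_surjective_endomorphism f hf
  exact Function.Injective.of_comp (f := fun g => e' (e g)) this

/-- In the Cayley graph of a free basis, full subgraphs have no cycles. -/
theorem card_inducedEdges_lt_of_injective_lift [Finite X] (P : GroupPresentation X G)
    (hP : Function.Injective (FreeGroup.lift P.gen)) {S : Finset G} (hS : S.Nonempty) :
    (P.inducedEdges S).card + 1 ≤ S.card := by
  classical
  let e : FreeGroup X ≃* G := MulEquiv.ofBijective _ ⟨hP, P.surjective_lift⟩
  have he : ∀ x, e.symm (P.gen x) = FreeGroup.of x := fun x => by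
    rw [MulEquiv.symm_apply_eq]
    exact (FreeGroup.lift_apply_of).symm
  -- Words of inverses are used so that right multiplication by a generator adds or removes the
  -- first letter.
  let N : G → List (X × Bool) := fun g => (e.symm g)⁻¹.toWord
  have hN : Function.Injective N := fun a b h =>
    e.symm.injective (inv_injective (FreeGroup.toWord_injective h))
  have hstep : ∀ g x, N (g * P.gen x) = (x, false) :: N g ∨ N g = (x, true) :: N (g * P.gen x) := by
    intro g x
    have h1 : N (g * P.gen x) = FreeGroup.reduce ((x, false) :: N g) := by
      have : (e.symm (g * P.gen x))⁻¹ = FreeGroup.mk ((x, false) :: N g) := by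
        have h2 : FreeGroup.mk ((x, false) :: N g) =
          (FreeGroup.of x)⁻¹ * FreeGroup.mk (N g) := rfl
        rw [h2, FreeGroup.mk_toWord, map_mul, he, mul_inv_rev]
      change (e.symm (g * P.gen x))⁻¹.toWord = _
      rw [this, FreeGroup.toWord_mk]
    have h3 : FreeGroup.reduce (N g) = N g := FreeGroup.reduce_toWord _
    rw [FreeGroup.reduce.cons, h3] at h1
    cases hg : N g with
    | nil =>
      rw [hg] at h1
      exact Or.inl h1
    | cons a t =>
      rw [hg] at h1
      dsimp only at h1
      split_ifs at h1 with h
      · right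
        rw [h1]
        congr 1
        exact Prod.ext h.1.symm (by simpa using h.2.symm)
      · exact Or.inl h1
  have hchild : ∀ d : G × X, d ∈ P.inducedEdges S → ∃ c ∈ S, ∃ p ∈ S, ∃ b,
      N c = (d.2, b) :: N p ∧ d.1 = if b then c else p := by
    rintro ⟨g, x⟩ hd
    rw [mem_inducedEdges] at hd
    rcases hstep g x with h | h
    · exact ⟨_, hd.2, _, hd.1, false, h, rfl⟩
    · exact ⟨_, hd.1, _, hd.2, true, h, rfl⟩
  -- `c d` is the end of the edge with the longer word and `p d` the other. The longer word
  -- determines the edge, and a shortest word in `S` is never the longer one, so there are at most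
  -- |S| − 1 edges.
  choose! c hcS p hpS b hNc hd1 using hchild
  obtain ⟨r, hr, hmin⟩ := Finset.exists_min_image S (fun g => (N g).length) hS
  have hcard : (P.inducedEdges S).card ≤ (S.erase r).card := by
    refine Finset.card_le_card_of_injOn c ?_ ?_
    · intro d hd
      refine Finset.mem_coe.2 (Finset.mem_erase.2 ⟨?_, hcS d hd⟩)
      intro h
      have h1 := hmin _ (hpS d hd)
      rw [← h, hNc d hd, List.length_cons] at h1
      omega
    · intro d hd d' hd' h
      have h1 := hNc d hd
      rw [h, hNc d' hd', List.cons.injEq, Prod.mk.injEq] at h1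
      obtain ⟨⟨h2, h3⟩, h4⟩ := h1
      refine Prod.ext ?_ h2.symm
      rw [hd1 d hd, hd1 d' hd', h, h3, hN h4]
  rw [Finset.card_erase_of_mem hr] at hcard
  have := Finset.card_pos.2 hS
  omega

/-- If the full subgraphs of the Cayley graph have no cycles, the generators are a free basis. -/
theorem injective_lift_of_card_inducedEdges_lt [Finite X] (P : GroupPresentation X G)
    (hE : ∀ S : Finset G, S.Nonempty → (P.inducedEdges S).card + 1 ≤ S.card) :
    Function.Injective (FreeGroup.lift P.gen) := by
  classical
  rw [injective_iff_map_eq_one]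
  intro w hw
  let L := w.toWord
  let V : ℕ → G := fun i => FreeGroup.lift P.gen (FreeGroup.mk (L.take i))
  let S : Finset G := (Finset.range (L.length + 1)).image V
  have hVS : ∀ i ≤ L.length, V i ∈ S := fun i hi =>
    Finset.mem_image_of_mem V (Finset.mem_range.2 (by omega))
  have htake : ∀ (i : ℕ) (hi : i < L.length), FreeGroup.mk (L.take (i + 1)) =
      FreeGroup.mk (L.take i) * FreeGroup.mk [L[i]] := fun i hi => by
    rw [FreeGroup.mul_mk, List.take_succ_eq_append_getElem hi]
  let C := {g // g ∈ S}
  let E := {d // d ∈ P.inducedEdges S}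
  let s : E → C := fun d => ⟨d.1.1, (mem_inducedEdges.1 d.2).1⟩
  let t : E → C := fun d => ⟨d.1.1 * P.gen d.1.2, (mem_inducedEdges.1 d.2).2⟩
  have hstep : ∀ (i : ℕ) (hi : i < L.length),
      (∃ d : E, s d = ⟨V i, hVS i hi.le⟩ ∧ t d = ⟨V (i + 1), hVS (i + 1) hi⟩ ∧
        FreeGroup.mk (L.take (i + 1)) = FreeGroup.mk (L.take i) * FreeGroup.of d.1.2) ∨
      (∃ d : E, t d = ⟨V i, hVS i hi.le⟩ ∧ s d = ⟨V (i + 1), hVS (i + 1) hi⟩ ∧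
        FreeGroup.mk (L.take (i + 1)) = FreeGroup.mk (L.take i) * (FreeGroup.of d.1.2)⁻¹) := by
    intro i hi
    have h1 := htake i hi
    have hVi := hVS i hi.le
    have hVi' := hVS (i + 1) hi
    obtain ⟨⟨x, b⟩, hx⟩ : ∃ a, L[i] = a := ⟨_, rfl⟩
    rw [hx] at h1
    cases b with
    | true =>
      left
      have h2 : V (i + 1) = V i * P.gen x := by
        change FreeGroup.lift P.gen _ = _
        rw [h1, map_mul, show FreeGroup.mk [(x, true)] = FreeGroup.of x from rfl,
          FreeGroup.lift_apply_of]
      exact ⟨⟨(V i, x), mem_inducedEdges.2 ⟨hVi, h2 ▸ hVi'⟩⟩, rfl, Subtype.ext h2.symm, h1⟩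
    | false =>
      right
      have h2 : V (i + 1) * P.gen x = V i := by
        change FreeGroup.lift P.gen _ * _ = _
        rw [h1, map_mul, show FreeGroup.mk [(x, false)] = (FreeGroup.of x)⁻¹ from rfl, map_inv,
          FreeGroup.lift_apply_of, inv_mul_cancel_right]
      exact ⟨⟨(V (i + 1), x), mem_inducedEdges.2 ⟨hVi', h2.symm ▸ hVi⟩⟩, Subtype.ext h2, rfl, h1⟩
  have hconn : ∀ A : Set C, A.Nonempty → (∀ d, s d ∈ A ↔ t d ∈ A) → A = Set.univ := by
    rintro A ⟨a, ha⟩ hA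
    have h0 : ∀ (i : ℕ) (hi : i ≤ L.length),
        (⟨V i, hVS i hi⟩ : C) ∈ A ↔ (⟨V 0, hVS 0 (Nat.zero_le _)⟩ : C) ∈ A := by
      intro i
      induction i with
      | zero => intro _; rfl
      | succ i ih =>
        intro hi
        rw [← ih (by omega)]
        rcases hstep i hi with ⟨d, h1, h2, -⟩ | ⟨d, h1, h2, -⟩
        · rw [← h1, ← h2, hA]
        · rw [← h1, ← h2, hA]
    have h0' : ∀ a : C, a ∈ A ↔ (⟨V 0, hVS 0 (Nat.zero_le _)⟩ : C) ∈ A := by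
      rintro ⟨a, ha⟩
      obtain ⟨i, hi, rfl⟩ := Finset.mem_image.1 ha
      exact h0 i (by have := Finset.mem_range.1 hi; omega)
    exact Set.eq_univ_of_forall fun b => (h0' b).2 ((h0' a).1 ha)
  have h0S : V 0 ∈ S := hVS 0 (Nat.zero_le _)
  -- `S` consists of the vertices on the closed path spelled by `w`. Potentials in the free group
  -- respect every edge once the tree is the whole graph; following the path then multiplies the
  -- potential by `w` and returns it unchanged.
  obtain ⟨T, hT, -, p, -, hp⟩ := exists_spanning_tree s t hconn (fun _ => FreeGroup X)
    (fun d => Equiv.mulRight (FreeGroup.of d.1.2)) (fun _ => 1) ⟨V 0, h0S⟩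
  have hTuniv : T = Finset.univ := by
    refine Finset.eq_univ_of_card T (le_antisymm (Finset.card_le_univ T) ?_)
    have h1 := hE S ⟨_, h0S⟩
    have h2 : Fintype.card C = S.card := Fintype.card_coe S
    have h3 : Fintype.card E = (P.inducedEdges S).card := Fintype.card_coe _
    omega
  have hp' : ∀ d : E, p (s d) * FreeGroup.of d.1.2 = p (t d) := fun d =>
    hp d (hTuniv ▸ Finset.mem_univ d)
  have hpV : ∀ (i : ℕ) (hi : i ≤ L.length),
      p ⟨V i, hVS i hi⟩ = p ⟨V 0, h0S⟩ * FreeGroup.mk (L.take i) := by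
    intro i
    induction i with
    | zero => intro _; exact (mul_one _).symm
    | succ i ih =>
      intro hi
      have ih := ih (by omega)
      rcases hstep i hi with ⟨d, h1, h2, h3⟩ | ⟨d, h1, h2, h3⟩
      · rw [← h2, ← hp', h1, ih, h3, mul_assoc]
      · rw [h3, ← mul_assoc, ← ih, ← h1, ← h2, eq_mul_inv_iff_mul_eq, hp']
  have hlast := hpV L.length le_rfl
  have hV : (⟨V L.length, hVS _ le_rfl⟩ : C) = ⟨V 0, h0S⟩ := by
    refine Subtype.ext ?_
    change FreeGroup.lift P.gen (FreeGroup.mk (L.take L.length)) = FreeGroup.lift P.gen 1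
    rw [List.take_length, FreeGroup.mk_toWord, hw, map_one]
  rw [hV, List.take_length, FreeGroup.mk_toWord] at hlast
  exact mul_eq_left.1 hlast.symm

end GroupPresentation

/-! ### Values of Ψ, connected sets, and a lower bound for Ξ -/

section

open scoped Pointwise
open Filter Topology

namespace GroupPresentation

variable {X : Type u} {G : Type v} [Group G] {P : GroupPresentation X G}

theorem Psi_nonneg [Nontrivial G] (P : GroupPresentation X G) : 0 ≤ P.Psi := by
  classical
  obtain ⟨g, hg⟩ := exists_ne (1 : G)
  let H : P.FiniteSubgraph := ⟨{1, g}, ∅, by simp, by simp⟩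
  have hH : H.beta0 = 2 := Finset.card_pair hg.symm
  refine le_trans ?_ (le_iSup₂_of_le H (by omega) le_rfl)
  rw [← EReal.coe_zero, EReal.coe_le_coe_iff, FiniteSubgraph.psi, hH]
  norm_num

theorem verts_mono_of_chain {C : ℕ → P.FiniteSubgraph} (hC : P.IsExhaustingChain C) :
    Monotone fun i => (C i).verts :=
  monotone_nat_of_le_succ hC.verts_mono

/-- From some index on, the members of a chain have at least two vertices, and a smaller denominator
only increases the quotient. -/
theorem Xi_le_Psi [Nontrivial G] (P : GroupPresentation X G) : P.Xi ≤ P.Psi := by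
  refine iSup₂_le fun C hC => ?_
  obtain ⟨g, hg⟩ := exists_ne (1 : G)
  obtain ⟨i, hi⟩ := hC.verts_exhaust 1
  obtain ⟨j, hj⟩ := hC.verts_exhaust g
  refine limsup_le_of_le (h := ?_)
  filter_upwards [eventually_ge_atTop (max i j)] with k hk
  have h1 : 1 < (C k).beta0 := Finset.one_lt_card.2
    ⟨1, verts_mono_of_chain hC ((le_max_left i j).trans hk) hi,
      g, verts_mono_of_chain hC ((le_max_right i j).trans hk) hj, hg.symm⟩
  refine le_trans ?_ (le_iSup₂_of_le (C k) h1 le_rfl)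
  rw [EReal.coe_le_coe_iff, FiniteSubgraph.xi, FiniteSubgraph.psi]
  have h2 : (1 : ℝ) < (C k).beta0 := by exact_mod_cast h1
  exact div_le_div_of_nonneg_left (by positivity) (by linarith) (by linarith)

section Psi

variable [Finite X]

theorem IsMinimal.card_inducedEdges_singleton (hP : P.IsMinimal) {S : Finset G}
    (hS : S.card = 1) : (P.inducedEdges S).card = 0 := by
  obtain ⟨g, rfl⟩ := Finset.card_eq_one.1 hS
  rw [Finset.card_eq_zero, Finset.eq_empty_iff_forall_notMem]
  intro e he
  rw [mem_inducedEdges, Finset.mem_singleton, Finset.mem_singleton] at he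
  exact hP.gen_ne_one e.2 (mul_eq_left.1 (he.2.trans he.1.symm))

/-- The converse of `Psi_le`. Single vertices do not enter the supremum; for them minimality
excludes loops. -/
theorem IsMinimal.card_inducedEdges_le_of_Psi_le (hP : P.IsMinimal) {q : ℝ} (hq : P.Psi ≤ q)
    {S : Finset G} (hS : S.Nonempty) :
    ((P.inducedEdges S).card : ℝ) ≤ (1 + q) * ((S.card : ℝ) - 1) := by
  rcases (Nat.one_le_iff_ne_zero.2 (Finset.card_pos.2 hS).ne').eq_or_lt with h | h
  · rw [hP.card_inducedEdges_singleton h.symm, ← h]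
    simp
  · have h1 := (P.le_Psi h).trans hq
    have h2 : (1 : ℝ) < S.card := by exact_mod_cast h
    rw [EReal.coe_le_coe_iff, div_le_iff₀ (by linarith)] at h1
    linarith

theorem IsMinimal.two_pow_le_card [Finite G] (hP : P.IsMinimal) :
    2 ^ Nat.card X ≤ Nat.card G := by
  have h := hP.two_pow_ncard_le Set.univ inferInstance
  rw [Set.ncard_univ, P.Gp_univ, Subgroup.card_top] at h
  exact h

/-- The whole group attains the value; a proper subset satisfies the stronger bound n(|S| − 1) by
edge connectivity. -/
theorem IsMinimal.Psi_eq_of_finite [Finite G] [Nontrivial G] (hP : P.IsMinimal) :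
    P.Psi = (((Nat.card X : ℝ) - 1 + (Nat.card X : ℝ) / ((Nat.card G : ℝ) - 1) : ℝ) : EReal) := by
  classical
  have := Fintype.ofFinite G
  have hn : (1 : ℝ) ≤ Nat.card X := by exact_mod_cast P.card_pos_of_nontrivial
  have hN : (1 : ℝ) < Nat.card G := by exact_mod_cast Finite.one_lt_card
  have hN' : (0 : ℝ) < (Nat.card G : ℝ) - 1 := by linarith
  have hcard : ((Finset.univ : Finset G).card : ℝ) = Nat.card G := by
    rw [Finset.card_univ, Nat.card_eq_fintype_card]
  have hEuniv : ((P.inducedEdges (Finset.univ : Finset G)).card : ℝ) =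
      Nat.card X * Nat.card G := by
    have h := P.card_inducedEdges_subgroup (S := Finset.univ) (K := ⊤) (by simp)
    have h2 : {x | P.gen x ∈ (⊤ : Subgroup G)} = Set.univ := by simp
    rw [h, h2, Set.ncard_univ, Nat.cast_mul, hcard]
  apply le_antisymm
  · refine P.Psi_le (add_nonneg (by linarith) (by positivity)) fun S hS => ?_
    rcases eq_or_ne S Finset.univ with rfl | hne
    · rw [hEuniv, hcard]
      apply le_of_eq
      field_simp
      ring
    · have h1 := hP.card_inducedEdges_add_le hS (by rwa [Ne, Finset.coe_eq_univ])
      have h2 : ((P.inducedEdges S).card : ℝ) + Nat.card X ≤ Nat.card X * S.card := by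
        exact_mod_cast h1
      have h3 : (1 : ℝ) ≤ S.card := by exact_mod_cast Finset.card_pos.2 hS
      have h4 : 0 ≤ (Nat.card X : ℝ) / ((Nat.card G : ℝ) - 1) * ((S.card : ℝ) - 1) :=
        mul_nonneg (by positivity) (by linarith)
      nlinarith
  · refine le_trans (le_of_eq ?_) (P.le_Psi (S := Finset.univ) ?_)
    · rw [EReal.coe_eq_coe_iff, hEuniv, hcard]
      field_simp
      ring
    · exact_mod_cast hcard ▸ hN

theorem IsMinimal.Psi_le_of_infinite [Infinite G] (hP : P.IsMinimal) :
    P.Psi ≤ (((Nat.card X : ℝ) - 1 : ℝ) : EReal) := by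
  classical
  have hn : (1 : ℝ) ≤ Nat.card X := by exact_mod_cast P.card_pos_of_nontrivial
  refine P.Psi_le (by linarith) fun S hS => ?_
  have h1 := hP.card_inducedEdges_add_le hS (coe_finset_ne_univ S)
  have h2 : ((P.inducedEdges S).card : ℝ) + Nat.card X ≤ Nat.card X * S.card := by
    exact_mod_cast h1
  linarith

theorem IsMinimal.exists_Psi_eq [Nontrivial G] (hP : P.IsMinimal) :
    ∃ ψ : ℝ, 0 ≤ ψ ∧ P.Psi = (ψ : EReal) := by
  have hbot : P.Psi ≠ ⊥ := ((EReal.bot_lt_coe 0).trans_le P.Psi_nonneg).ne'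
  have htop : P.Psi ≠ ⊤ := by
    rcases finite_or_infinite G with h | h
    · rw [hP.Psi_eq_of_finite]
      exact EReal.coe_ne_top _
    · exact (hP.Psi_le_of_infinite.trans_lt (EReal.coe_lt_top _)).ne
  refine ⟨P.Psi.toReal, ?_, (EReal.coe_toReal htop hbot).symm⟩
  exact EReal.toReal_nonneg P.Psi_nonneg

end Psi

section Connected

/-- A finite set of vertices whose full subgraph is connected. -/
def IsConnectedSet (P : GroupPresentation X G) (S : Finset G) : Prop :=
  S.Nonempty ∧ ∀ A : Set G, (∃ g ∈ S, g ∈ A) →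
    (∀ g x, g ∈ S → g * P.gen x ∈ S → (g ∈ A ↔ g * P.gen x ∈ A)) → ∀ g ∈ S, g ∈ A

theorem IsConnectedSet.isConnected_fullSubgraph [Finite X] {S : Finset G}
    (hS : P.IsConnectedSet S) : (P.fullSubgraph S).IsConnected := by
  obtain ⟨⟨g, hg⟩, hS⟩ := hS
  refine ⟨⟨Quiver.WeaklyConnectedComponent.mk (⟨g, hg⟩ : (P.fullSubgraph S).Vertex)⟩, ⟨?_⟩⟩
  have key : ∀ a b : (P.fullSubgraph S).Vertex, Quiver.WeaklyConnectedComponent.mk a =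
      Quiver.WeaklyConnectedComponent.mk b := by
    intro a b
    let vert : ∀ g, g ∈ S → (P.fullSubgraph S).Vertex := fun g h => ⟨g, h⟩
    obtain ⟨h, h'⟩ := hS {g | ∃ h : g ∈ S,
      Quiver.WeaklyConnectedComponent.mk (vert g h) =
        Quiver.WeaklyConnectedComponent.mk b} ⟨b.1, b.2, b.2, rfl⟩ (fun g x h1 h2 => by
      have e : vert g h1 ⟶ vert (g * P.gen x) h2 := ⟨x, mem_inducedEdges.2 ⟨h1, h2⟩, rfl⟩
      have := weaklyConnectedComponent_eq_of_hom e
      constructor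
      · rintro ⟨_, h⟩
        exact ⟨h2, this.trans h⟩
      · rintro ⟨_, h⟩
        exact ⟨h1, this.symm.trans h⟩) a.1 a.2
    exact h'
  intro c d
  obtain ⟨a, rfl⟩ := Quotient.exists_rep c
  obtain ⟨b, rfl⟩ := Quotient.exists_rep d
  exact key a b

theorem isConnectedSet_singleton (P : GroupPresentation X G) (g : G) :
    P.IsConnectedSet {g} := by
  refine ⟨⟨g, by simp⟩, ?_⟩
  rintro A ⟨h, hh, hA⟩ - g' hg'
  rw [Finset.mem_singleton] at hh hg'
  rwa [hg', ← hh]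

variable [DecidableEq G]

theorem isConnectedSet_pair (P : GroupPresentation X G) (x : X) :
    P.IsConnectedSet {1, P.gen x} := by
  refine ⟨⟨1, by simp⟩, ?_⟩
  rintro A ⟨h, hh, hA⟩ hcl g hg
  have := hcl 1 x (by simp) (by simp)
  rw [one_mul] at this
  rw [Finset.mem_insert, Finset.mem_singleton] at hh hg
  rcases hh with rfl | rfl <;> rcases hg with rfl | rfl <;> tauto

theorem IsConnectedSet.union {A B : Finset G} (hA : P.IsConnectedSet A) (hB : P.IsConnectedSet B)
    (h : (A ∩ B).Nonempty) : P.IsConnectedSet (A ∪ B) := by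
  obtain ⟨v, hv⟩ := h
  rw [Finset.mem_inter] at hv
  refine ⟨⟨v, Finset.mem_union_left _ hv.1⟩, ?_⟩
  rintro C ⟨g, hg, hgC⟩ hcl
  have h1 : (∃ g ∈ A, g ∈ C) → ∀ g ∈ A, g ∈ C := fun h => hA.2 C h fun g x h1 h2 =>
    hcl g x (Finset.mem_union_left _ h1) (Finset.mem_union_left _ h2)
  have h2 : (∃ g ∈ B, g ∈ C) → ∀ g ∈ B, g ∈ C := fun h => hB.2 C h fun g x h1 h2 =>
    hcl g x (Finset.mem_union_right _ h1) (Finset.mem_union_right _ h2)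
  have hvC : v ∈ C := by
    rcases Finset.mem_union.1 hg with hg | hg
    · exact h1 ⟨g, hg, hgC⟩ v hv.1
    · exact h2 ⟨g, hg, hgC⟩ v hv.2
  intro g hg
  rcases Finset.mem_union.1 hg with hg | hg
  · exact h1 ⟨v, hv.1, hvC⟩ g hg
  · exact h2 ⟨v, hv.2, hvC⟩ g hg

theorem IsConnectedSet.smul {S : Finset G} (hS : P.IsConnectedSet S) (g : G) :
    P.IsConnectedSet (g • S) := by
  refine ⟨hS.1.smul_finset, ?_⟩
  rintro A ⟨h, hh, hA⟩ hcl k hk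
  rw [← Finset.inv_smul_mem_iff, smul_eq_mul] at hh hk
  have := hS.2 {a | g * a ∈ A} ⟨_, hh, by simpa using hA⟩ (fun a x h1 h2 => by
    have := hcl (g * a) x (Finset.smul_mem_smul_finset h1)
      (by rw [mul_assoc]; exact Finset.smul_mem_smul_finset h2)
    rwa [mul_assoc] at this) _ hk
  simpa using this

/-- The elements joined to 1 by a connected set form a subgroup, and it contains the generators. -/
theorem exists_isConnectedSet (P : GroupPresentation X G) (g : G) :
    ∃ S : Finset G, P.IsConnectedSet S ∧ 1 ∈ S ∧ g ∈ S := by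
  let K : Subgroup G :=
    { carrier := {g | ∃ S : Finset G, P.IsConnectedSet S ∧ 1 ∈ S ∧ g ∈ S}
      one_mem' := ⟨{1}, P.isConnectedSet_singleton 1, by simp, by simp⟩
      mul_mem' := by
        rintro a b ⟨S, hS, hS1, ha⟩ ⟨T, hT, hT1, hb⟩
        have h : a ∈ a • T := by simpa using Finset.smul_mem_smul_finset (a := a) hT1
        exact ⟨S ∪ a • T, hS.union (hT.smul a) ⟨a, Finset.mem_inter.2 ⟨ha, h⟩⟩,
          Finset.mem_union_left _ hS1, Finset.mem_union_right _ (Finset.smul_mem_smul_finset hb)⟩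
      inv_mem' := by
        rintro a ⟨S, hS, hS1, ha⟩
        refine ⟨a⁻¹ • S, hS.smul _, Finset.inv_smul_mem_iff.1 (by simpa using ha), ?_⟩
        simpa using Finset.smul_mem_smul_finset (a := a⁻¹) hS1 }
  have hK : K = ⊤ := P.eq_top_of_gen_mem fun x =>
    ⟨{1, P.gen x}, P.isConnectedSet_pair x, by simp, by simp⟩
  exact (hK ▸ Subgroup.mem_top g : g ∈ K)

/-- A disconnected set of vertices is the disjoint union of two parts without edges between
them. -/
theorem exists_split [Finite X] (P : GroupPresentation X G) {S : Finset G} (hS : S.Nonempty)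
    (h : ¬ P.IsConnectedSet S) :
    ∃ A B : Finset G, A.Nonempty ∧ B.Nonempty ∧ A.card + B.card = S.card ∧
      (P.inducedEdges S).card ≤ (P.inducedEdges A).card + (P.inducedEdges B).card := by
  classical
  simp only [IsConnectedSet, hS, true_and] at h
  push Not at h
  obtain ⟨C, ⟨a, haS, haC⟩, hcl, b, hbS, hbC⟩ := h
  refine ⟨S.filter (· ∈ C), S.filter (· ∉ C), ⟨a, Finset.mem_filter.2 ⟨haS, haC⟩⟩,
    ⟨b, Finset.mem_filter.2 ⟨hbS, hbC⟩⟩, Finset.card_filter_add_card_filter_not _, ?_⟩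
  refine (Finset.card_le_card ?_).trans (Finset.card_union_le _ _)
  intro e he
  rw [mem_inducedEdges] at he
  have := hcl e.1 e.2 he.1 he.2
  simp only [Finset.mem_union, mem_inducedEdges, Finset.mem_filter]
  tauto

/-- Splitting a disconnected set is harmless: the bounds for the parts add up to 1 + q less than the
bound for the whole. -/
theorem card_inducedEdges_le_of_isConnectedSet [Finite X] (P : GroupPresentation X G) {q : ℝ}
    (hq : 0 ≤ 1 + q) (h : ∀ S, P.IsConnectedSet S →
      ((P.inducedEdges S).card : ℝ) ≤ (1 + q) * ((S.card : ℝ) - 1))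
    (S : Finset G) (hS : S.Nonempty) :
    ((P.inducedEdges S).card : ℝ) ≤ (1 + q) * ((S.card : ℝ) - 1) := by
  induction hk : S.card using Nat.strong_induction_on generalizing S with
  | _ k ih =>
    subst hk
    by_cases hc : P.IsConnectedSet S
    · exact h S hc
    · obtain ⟨A, B, hA, hB, hAB, hE⟩ := P.exists_split hS hc
      have hA' := Finset.card_pos.2 hA
      have hB' := Finset.card_pos.2 hB
      have h1 := ih A.card (by omega) A hA rfl
      have h2 := ih B.card (by omega) B hB rfl
      have h3 : ((P.inducedEdges S).card : ℝ) ≤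
        (P.inducedEdges A).card + (P.inducedEdges B).card := by exact_mod_cast hE
      have h4 : (S.card : ℝ) = A.card + B.card := by exact_mod_cast hAB.symm
      rw [h4]
      nlinarith

/-- Sets of vertices on which the bound by `Psi` is attained are connected. -/
theorem isConnectedSet_of_card_eq [Finite X] (P : GroupPresentation X G) {ψ : ℝ} (hψ : 0 ≤ ψ)
    (hE : ∀ S : Finset G, S.Nonempty →
      ((P.inducedEdges S).card : ℝ) ≤ (1 + ψ) * ((S.card : ℝ) - 1))
    {S : Finset G} (hS : S.Nonempty)
    (h : ((P.inducedEdges S).card : ℝ) = (1 + ψ) * ((S.card : ℝ) - 1)) :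
    P.IsConnectedSet S := by
  by_contra hc
  obtain ⟨A, B, hA, hB, hAB, hE'⟩ := P.exists_split hS hc
  have h1 := hE A hA
  have h2 := hE B hB
  have h3 : ((P.inducedEdges S).card : ℝ) ≤
    (P.inducedEdges A).card + (P.inducedEdges B).card := by exact_mod_cast hE'
  have h4 : (S.card : ℝ) = A.card + B.card := by exact_mod_cast hAB.symm
  rw [h, h4] at h3
  nlinarith

end Connected

section Xi

variable [Finite X]

theorem countable_of_finite (P : GroupPresentation X G) : Countable G := by
  have h : Function.Surjective fun L : List (X × Bool) =>
      FreeGroup.lift P.gen (FreeGroup.mk L) :=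
    P.surjective_lift.comp Quot.mk_surjective
  exact h.countable

/-- If there are arbitrarily large connected sets with many edges, then every finite connected set
can be enlarged to one whose quotient is nearly as large. -/
theorem exists_extension [DecidableEq G] (P : GroupPresentation X G) {q : ℝ} (hq : 0 ≤ 1 + q)
    (h : ∀ N : ℕ, ∃ T, P.IsConnectedSet T ∧ N ≤ T.card ∧
      (1 + q) * ((T.card : ℝ) - 1) ≤ (P.inducedEdges T).card)
    (i : ℕ) (g : G) (B : Finset G) (hB : P.IsConnectedSet B) (hB1 : (1 : G) ∈ B) :
    ∃ C, P.IsConnectedSet C ∧ (1 : G) ∈ C ∧ B ⊆ C ∧ g ∈ C ∧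
      q - (1 + q) / ((i : ℝ) + 1) ≤ (P.fullSubgraph C).xi := by
  obtain ⟨D, hD, hD1, hDg⟩ := P.exists_isConnectedSet g
  have hBD := hB.union hD ⟨1, Finset.mem_inter.2 ⟨hB1, hD1⟩⟩
  -- Adjoining `B ∪ D` to `T` costs at most (1 + q)(|B ∪ D| + 1) in β₂; this threshold makes the
  -- cost at most the fraction (1 + q)/(i + 1) of the vertices.
  obtain ⟨T₀, hT₀, hN, hE⟩ := h ((i + 1) * ((B ∪ D).card + 1))
  obtain ⟨t, ht⟩ := hT₀.1
  have hT1 : (1 : G) ∈ t⁻¹ • T₀ := Finset.inv_smul_mem_iff.1 (by simpa using ht)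
  have hT := hT₀.smul t⁻¹
  rw [← P.card_inducedEdges_smul t⁻¹, ← Finset.card_smul_finset t⁻¹ T₀] at hE
  rw [← Finset.card_smul_finset t⁻¹ T₀] at hN
  generalize t⁻¹ • T₀ = T at hT1 hT hE hN
  have hBD1 : (1 : G) ∈ B ∪ D := Finset.mem_union_left _ hB1
  have hC := hBD.union hT ⟨1, Finset.mem_inter.2 ⟨hBD1, hT1⟩⟩
  have hBg : g ∈ B ∪ D := Finset.mem_union_right _ hDg
  have hsub : B ⊆ B ∪ D := Finset.subset_union_left
  generalize B ∪ D = B' at hBD hN hBD1 hC hBg hsub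
  refine ⟨B' ∪ T, hC, Finset.mem_union_left _ hBD1, hsub.trans Finset.subset_union_left,
    Finset.mem_union_left _ hBg, ?_⟩
  have h1 := FiniteSubgraph.beta2_add_beta0_of_isConnected hC.isConnected_fullSubgraph
  have h2 : ((P.fullSubgraph (B' ∪ T)).beta2 : ℝ) + (B' ∪ T).card =
      (P.inducedEdges (B' ∪ T)).card + 1 := by exact_mod_cast h1
  have h3 : ((P.inducedEdges T).card : ℝ) ≤ (P.inducedEdges (B' ∪ T)).card := by
    exact_mod_cast Finset.card_le_card (P.inducedEdges_mono Finset.subset_union_right)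
  have h4 : ((B' ∪ T).card : ℝ) ≤ B'.card + T.card := by
    exact_mod_cast Finset.card_union_le B' T
  have h4' : (T.card : ℝ) ≤ (B' ∪ T).card := by
    exact_mod_cast Finset.card_le_card Finset.subset_union_right
  have h5 : ((i : ℝ) + 1) * (B'.card + 1) ≤ T.card := by exact_mod_cast hN
  have hTpos : (0 : ℝ) < T.card := by exact_mod_cast Finset.card_pos.2 ⟨1, hT1⟩
  change _ ≤ ((P.fullSubgraph (B' ∪ T)).beta2 : ℝ) / ((B' ∪ T).card : ℝ)
  rw [le_div_iff₀ (hTpos.trans_le h4')]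
  have h6 : (B'.card : ℝ) + 1 ≤ (B' ∪ T).card / ((i : ℝ) + 1) := by
    rw [le_div_iff₀ (by positivity)]
    linarith
  have h7 : (q - (1 + q) / ((i : ℝ) + 1)) * ((B' ∪ T).card : ℝ) =
      q * (B' ∪ T).card - (1 + q) * ((B' ∪ T).card / ((i : ℝ) + 1)) := by ring
  have h8 := mul_le_mul_of_nonneg_left h6 hq
  have h9 := mul_le_mul_of_nonneg_left h4 hq
  rw [h7]
  nlinarith

/-- Iterated extension, forcing in the i-th element of an enumeration of `G` at stage i, produces an
exhausting chain whose quotients have limes superior at least q. -/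
theorem le_Xi (P : GroupPresentation X G) {q : ℝ} (hq : 0 ≤ 1 + q)
    (h : ∀ N : ℕ, ∃ T, P.IsConnectedSet T ∧ N ≤ T.card ∧
      (1 + q) * ((T.card : ℝ) - 1) ≤ (P.inducedEdges T).card) : (q : EReal) ≤ P.Xi := by
  classical
  have := P.countable_of_finite
  obtain ⟨e, he⟩ := exists_surjective_nat G
  choose next hn hn1 hnsub hng hnxi using P.exists_extension hq h
  let S : ℕ → {B : Finset G // P.IsConnectedSet B ∧ (1 : G) ∈ B} := fun i =>
    Nat.rec ⟨{1}, P.isConnectedSet_singleton 1, Finset.mem_singleton_self 1⟩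
      (fun i B => ⟨next i (e i) B.1 B.2.1 B.2.2, hn _ _ _ _ _, hn1 _ _ _ _ _⟩) i
  have hmono : ∀ i, (S i).1 ⊆ (S (i + 1)).1 := fun i => hnsub i (e i) _ _ _
  have hmono' : Monotone fun i => (S i).1 := monotone_nat_of_le_succ hmono
  have hmem : ∀ i, e i ∈ (S (i + 1)).1 := fun i => hng i (e i) _ _ _
  have hchain : P.IsExhaustingChain fun i => P.fullSubgraph (S i).1 :=
    { connected := fun i => (S i).2.1.isConnected_fullSubgraph
      verts_mono := hmono
      edges_mono := fun i => P.inducedEdges_mono (hmono i)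
      verts_exhaust := fun g => by
        obtain ⟨i, rfl⟩ := he g
        exact ⟨i + 1, hmem i⟩
      edges_exhaust := fun d => by
        obtain ⟨i, hi⟩ := he d.1
        obtain ⟨j, hj⟩ := he (d.1 * P.gen d.2)
        refine ⟨max (i + 1) (j + 1), mem_inducedEdges.2 ⟨?_, ?_⟩⟩
        · exact hmono' (le_max_left _ _) (hi ▸ hmem i)
        · exact hmono' (le_max_right _ _) (hj ▸ hmem j) }
  refine le_trans ?_ (le_iSup₂_of_le _ hchain le_rfl)
  -- The initial set {1} carries no estimate, so the index is shifted.
  rw [← limsup_nat_add _ 1]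
  have hlim : Tendsto (fun i : ℕ => ((q - (1 + q) / ((i : ℝ) + 1) : ℝ) : EReal)) atTop
      (𝓝 (q : EReal)) := by
    refine (continuous_coe_real_ereal.tendsto q).comp ?_
    have := (tendsto_one_div_add_atTop_nhds_zero_nat (𝕜 := ℝ)).const_mul (1 + q)
    simpa [div_eq_mul_inv] using this.const_sub q
  rw [← hlim.limsup_eq]
  refine limsup_le_limsup (Eventually.of_forall fun i => ?_)
  exact EReal.coe_le_coe_iff.2 (hnxi i (e i) _ _ _)

end Xi

end GroupPresentation

end

/-! ### The formula Ψ(G) = max(Ξ(G), Ψ(H)) -/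

section

open scoped Pointwise
open Filter Topology

namespace GroupPresentation

variable {X : Type u} {G : Type v} [Group G] {P : GroupPresentation X G}

section FiniteSubgroup

theorem Psi_eq_bot [Subsingleton G] (P : GroupPresentation X G) : P.Psi = ⊥ := by
  refine le_bot_iff.1 (iSup₂_le fun H hH => ?_)
  exact absurd hH (not_lt.2 (Finset.card_le_one_of_subsingleton _))

variable [Finite X]

theorem IsMinimal.Psi_induced_eq (hP : P.IsMinimal) (Y : Set X) [Finite (P.Gp Y)]
    [Nontrivial (P.Gp Y)] : (P.induced Y).Psi =
      ((((Y.ncard : ℝ) - 1) + (Y.ncard : ℝ) / ((Nat.card (P.Gp Y) : ℝ) - 1) : ℝ) : EReal) := by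
  rw [(hP.induced Y).Psi_eq_of_finite]
  rfl

/-- By minimality only generators in `Y` lie in `Gp(Y)`, so the full subgraph on this subgroup is
its own Cayley graph, and it competes for Ψ(G). -/
theorem IsMinimal.Psi_induced_le (hP : P.IsMinimal) (Y : Set X) [Finite (P.Gp Y)] :
    (P.induced Y).Psi ≤ P.Psi := by
  classical
  rcases subsingleton_or_nontrivial (P.Gp Y) with h | h
  · rw [Psi_eq_bot]
    exact bot_le
  · rw [hP.Psi_induced_eq]
    let S : Finset G := (P.Gp Y : Set G).toFinite.toFinset
    have hS : (P.Gp Y : Set G) = S := (Set.Finite.coe_toFinset _).symm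
    have hSc : S.card = Nat.card (P.Gp Y) := by
      rw [← Nat.card_eq_finsetCard]
      exact Nat.card_congr (Equiv.setCongr hS.symm)
    have hY : {x | P.gen x ∈ P.Gp Y} = Y := by
      ext x
      exact ⟨fun h => by_contra fun hx => hP.gen_notMem_Gp hx h, P.gen_mem_Gp⟩
    have hE := P.card_inducedEdges_subgroup hS
    rw [hY, hSc] at hE
    have h1 : 1 < Nat.card (P.Gp Y) := Finite.one_lt_card
    refine le_trans (le_of_eq ?_) (P.le_Psi (S := S) (by rwa [hSc]))
    have h2 : (1 : ℝ) < Nat.card (P.Gp Y) := by exact_mod_cast h1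
    have h3 : (Nat.card (P.Gp Y) : ℝ) - 1 ≠ 0 := by linarith
    rw [EReal.coe_eq_coe_iff, hE, hSc]
    push_cast
    field_simp
    ring

end FiniteSubgroup

variable [Finite X]

/-- If `Psi` exceeds `Xi`, then it is attained on a finite set of vertices, and the sets on which
it is attained have bounded size. -/
theorem IsMinimal.exists_maximal_of_Xi_lt [Nontrivial G] (hP : P.IsMinimal) {ψ : ℝ} (hψ0 : 0 ≤ ψ)
    (hψ : P.Psi = ψ) (hXi : P.Xi < P.Psi) :
    ∃ W : Finset G, 2 ≤ W.card ∧
      ((P.inducedEdges W).card : ℝ) = (1 + ψ) * ((W.card : ℝ) - 1) ∧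
      ∀ T : Finset G, 2 ≤ T.card →
        ((P.inducedEdges T).card : ℝ) = (1 + ψ) * ((T.card : ℝ) - 1) → T.card ≤ W.card := by
  classical
  obtain ⟨q₁, hq₁, hq₁ψ⟩ := EReal.lt_iff_exists_real_btwn.1 hXi
  rw [hψ, EReal.coe_lt_coe_iff] at hq₁ψ
  -- The maximum with −1/2 keeps 1 + q ≥ 0 and stays below ψ because ψ ≥ 0.
  obtain ⟨q, hq1, hqψ, hXiq⟩ : ∃ q : ℝ, 0 ≤ 1 + q ∧ q < ψ ∧ P.Xi < q := by
    refine ⟨max q₁ (-1 / 2), ?_, max_lt hq₁ψ (by linarith),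
      hq₁.trans_le (EReal.coe_le_coe_iff.2 (le_max_left _ _))⟩
    have := le_max_right q₁ (-1 / 2)
    linarith
  have hle := fun S (hS : S.Nonempty) => hP.card_inducedEdges_le_of_Psi_le (S := S) hψ.le hS
  obtain ⟨N, hN⟩ : ∃ N : ℕ, ∀ T, P.IsConnectedSet T → N ≤ T.card →
      ((P.inducedEdges T).card : ℝ) < (1 + q) * ((T.card : ℝ) - 1) := by
    by_contra! h
    exact (P.le_Xi hq1 h).not_gt hXiq
  let 𝒲 : Set (Finset G) := {T | 2 ≤ T.card ∧
    ((P.inducedEdges T).card : ℝ) = (1 + ψ) * ((T.card : ℝ) - 1)}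
  have hbdd : ∀ T ∈ 𝒲, T.card < N := by
    rintro T ⟨hT2, hT⟩
    have hTne : T.Nonempty := Finset.card_pos.1 (by omega)
    by_contra hlt
    have h1 := hN T (P.isConnectedSet_of_card_eq hψ0 hle hTne hT) (not_lt.1 hlt)
    have h2 : (2 : ℝ) ≤ T.card := by exact_mod_cast hT2
    rw [hT] at h1
    nlinarith
  have hne : 𝒲.Nonempty := by
    -- If ψ = 0, the two ends of one edge attain the bound.
    rcases hψ0.eq_or_lt with h0 | hpos
    · have : Nonempty X := (Nat.card_pos_iff.1 P.card_pos_of_nontrivial).1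
      obtain ⟨x⟩ := this
      have hc : ({1, P.gen x} : Finset G).card = 2 := Finset.card_pair (hP.gen_ne_one x).symm
      refine ⟨{1, P.gen x}, hc.ge, le_antisymm (hle _ ⟨1, by simp⟩) ?_⟩
      have h1 : 1 ≤ (P.inducedEdges {1, P.gen x}).card :=
        Finset.card_pos.2 ⟨(1, x), mem_inducedEdges.2 (by simp)⟩
      have h2 : (1 : ℝ) ≤ (P.inducedEdges {1, P.gen x}).card := by exact_mod_cast h1
      rw [hc, ← h0]
      push_cast
      linarith
    · by_contra hempty
      -- Small sets realize finitely many quotients below ψ, and large connected sets stay below q.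
      -- If ψ were not attained, the maximum r of these values would bound Ψ by a number less than
      -- ψ.
      let F : Finset ℝ := insert (max q 0) <|
        (((Finset.range (Nat.card X * N + 1)) ×ˢ (Finset.range N)).image
          fun p : ℕ × ℕ => (p.1 : ℝ) / ((p.2 : ℝ) - 1) - 1).filter (· < ψ)
      have hF : F.Nonempty := ⟨_, Finset.mem_insert_self _ _⟩
      let r := F.max' hF
      have hrψ : r < ψ := by
        rcases Finset.mem_insert.1 (F.max'_mem hF) with h | h
        · change F.max' hF < ψ
          rw [h]
          exact max_lt hqψ hpos
        · exact (Finset.mem_filter.1 h).2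
      have hr0 : max q 0 ≤ r := F.le_max' _ (Finset.mem_insert_self _ _)
      have hr0' : 0 ≤ r := (le_max_right _ _).trans hr0
      have hqr : q ≤ r := (le_max_left _ _).trans hr0
      have hconn : ∀ T, P.IsConnectedSet T →
          ((P.inducedEdges T).card : ℝ) ≤ (1 + r) * ((T.card : ℝ) - 1) := by
        intro T hT
        have hTpos := Finset.card_pos.2 hT.1
        rcases (Nat.one_le_iff_ne_zero.2 hTpos.ne').eq_or_lt with h1 | h1
        · rw [hP.card_inducedEdges_singleton h1.symm, ← h1]
          simp
        have h1' : (1 : ℝ) < T.card := by exact_mod_cast h1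
        rcases le_or_gt N T.card with h2 | h2
        · refine (hN T hT h2).le.trans (mul_le_mul_of_nonneg_right (by linarith) (by linarith))
        · have h3 : ((P.inducedEdges T).card : ℝ) / ((T.card : ℝ) - 1) - 1 ∈ F := by
            refine Finset.mem_insert_of_mem (Finset.mem_filter.2 ⟨Finset.mem_image.2
              ⟨((P.inducedEdges T).card, T.card), Finset.mem_product.2
                ⟨Finset.mem_range.2 ?_, Finset.mem_range.2 h2⟩, rfl⟩, ?_⟩)
            · exact Nat.lt_succ_of_le ((P.card_inducedEdges_le T).trans
                (Nat.mul_le_mul_left _ h2.le))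
            · have h4 : ((P.inducedEdges T).card : ℝ) < (1 + ψ) * ((T.card : ℝ) - 1) :=
                lt_of_le_of_ne (hle T hT.1) fun h => hempty ⟨T, h1, h⟩
              rw [sub_lt_iff_lt_add, div_lt_iff₀ (by linarith)]
              linarith
          have h5 := F.le_max' _ h3
          change _ ≤ r at h5
          rw [sub_le_iff_le_add, div_le_iff₀ (by linarith)] at h5
          linarith
      have h6 := P.Psi_le hr0' (P.card_inducedEdges_le_of_isConnectedSet (by linarith) hconn)
      rw [hψ, EReal.coe_le_coe_iff] at h6
      linarith
  obtain ⟨W, hW, hmax⟩ := WellFounded.has_min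
    (InvImage.wf (fun T : Finset G => N - T.card) Nat.lt_wfRel.wf) 𝒲 hne
  refine ⟨W, hW.1, hW.2, fun T hT2 hT => ?_⟩
  have h1 : ¬ N - T.card < N - W.card := hmax T ⟨hT2, hT⟩
  have h2 := hbdd T ⟨hT2, hT⟩
  have h3 := hbdd W hW
  omega

/-- A largest set `W` attaining ψ is a subgroup: its union with a translate that meets it attains ψ
as well. Hence ψ = a − 1 + a/(|W| − 1), with a the number of generators in `W`, and this is compared
with the value for `Y`. -/
theorem IsMinimal.Psi_le_induced [Nontrivial G] (hP : P.IsMinimal) {Y : Set X}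
    (hY : P.IsExtremalFinite Y) (hXi : P.Xi < P.Psi) : P.Psi ≤ (P.induced Y).Psi := by
  classical
  obtain ⟨ψ, hψ0, hψ⟩ := hP.exists_Psi_eq
  have hle := fun S (hS : S.Nonempty) => hP.card_inducedEdges_le_of_Psi_le (S := S) hψ.le hS
  obtain ⟨W₀, hW₀2, hW₀E, hW₀max⟩ := hP.exists_maximal_of_Xi_lt hψ0 hψ hXi
  obtain ⟨w, hw⟩ : W₀.Nonempty := Finset.card_pos.1 (by omega)
  obtain ⟨W, hW1, hW2, hWE, hmax⟩ : ∃ W : Finset G, (1 : G) ∈ W ∧ 2 ≤ W.card ∧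
      ((P.inducedEdges W).card : ℝ) = (1 + ψ) * ((W.card : ℝ) - 1) ∧
      ∀ T : Finset G, 2 ≤ T.card →
        ((P.inducedEdges T).card : ℝ) = (1 + ψ) * ((T.card : ℝ) - 1) → T.card ≤ W.card := by
    refine ⟨w⁻¹ • W₀, Finset.inv_smul_mem_iff.1 (by simpa using hw), ?_, ?_, ?_⟩
    · rwa [Finset.card_smul_finset]
    · rwa [Finset.card_smul_finset, P.card_inducedEdges_smul]
    · rwa [Finset.card_smul_finset]
  obtain ⟨K, hK⟩ : ∃ K : Subgroup G, (K : Set G) = W := by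
    refine exists_subgroup_coe_eq hW1 fun g hg => ?_
    have hcard := Finset.card_union_add_card_inter (g • W) W
    rw [Finset.card_smul_finset] at hcard
    have h1 := hle _ hg
    have h2 := hle (g • W ∪ W) ⟨1, Finset.mem_union_right _ hW1⟩
    have h3 := P.card_inducedEdges_add_le (g • W) W
    rw [P.card_inducedEdges_smul] at h3
    have h3' : ((P.inducedEdges W).card : ℝ) + (P.inducedEdges W).card ≤
        (P.inducedEdges (g • W ∪ W)).card + (P.inducedEdges (g • W ∩ W)).card := by
      exact_mod_cast h3
    have hcard' : ((g • W ∪ W).card : ℝ) + (g • W ∩ W).card = W.card + W.card := by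
      exact_mod_cast hcard
    have h4 : (1 + ψ) * (((g • W ∪ W).card : ℝ) - 1) + (1 + ψ) * (((g • W ∩ W).card : ℝ) - 1) =
        (1 + ψ) * ((W.card : ℝ) - 1) + (1 + ψ) * ((W.card : ℝ) - 1) := by
      rw [← mul_add, ← mul_add]
      congr 1
      linarith
    have h5 := hmax (g • W ∪ W) (hW2.trans (Finset.card_le_card Finset.subset_union_right))
      (by linarith)
    have h6 : W = g • W ∪ W := Finset.eq_of_subset_of_card_le Finset.subset_union_right h5
    exact Finset.eq_of_subset_of_card_le (Finset.union_eq_right.1 h6.symm)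
      (by rw [Finset.card_smul_finset])
  have hE := P.card_inducedEdges_subgroup hK
  have hpow := hP.two_pow_ncard_le_of_coe_eq hK
  obtain ⟨hfin, hGp⟩ := P.finite_Gp_of_coe_eq hK
  have hcard := hY.card_max _ hfin
  have hmin := hY.order_min _ hfin
  have hWr : (2 : ℝ) ≤ W.card := by exact_mod_cast hW2
  rw [hE, Nat.cast_mul] at hWE
  set Z := {x | P.gen x ∈ K}
  have hZpos : 0 < Z.ncard := by
    rw [Nat.pos_iff_ne_zero]
    intro h
    rw [h] at hWE
    simp only [CharP.cast_eq_zero, zero_mul] at hWE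
    nlinarith
  have hYfin := hY.finite
  have hYne : Y.Nonempty := (Set.ncard_pos Y.toFinite).1 (hZpos.trans_le hcard)
  obtain ⟨y, hy⟩ := hYne
  have hnt : Nontrivial (P.Gp Y) := ⟨⟨⟨P.gen y, P.gen_mem_Gp hy⟩, 1, fun h =>
    hP.gen_ne_one y (congrArg Subtype.val h)⟩⟩
  rw [hψ, hP.Psi_induced_eq, EReal.coe_le_coe_iff]
  have hH : (1 : ℝ) < Nat.card (P.Gp Y) := by exact_mod_cast Finite.one_lt_card
  have hψeq : ψ = (Z.ncard : ℝ) - 1 + Z.ncard / ((W.card : ℝ) - 1) := by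
    have : (W.card : ℝ) - 1 ≠ 0 := by linarith
    field_simp
    linarith
  rw [hψeq]
  -- If a = m, the least order wins. If a < m, then |W| ≥ 2^a ≥ a + 1 gives ψ ≤ a ≤ m − 1.
  rcases hcard.eq_or_lt with h | h
  · have h1 : (Nat.card (P.Gp Y) : ℝ) ≤ W.card := by exact_mod_cast (hmin h).trans hGp
    rw [h]
    have := div_le_div_of_nonneg_left (Nat.cast_nonneg (α := ℝ) Y.ncard)
      (sub_pos.2 hH) (sub_le_sub_right h1 1)
    linarith
  · have h1 : (Z.ncard : ℝ) + 1 ≤ Y.ncard := by exact_mod_cast h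
    have h2 : (Z.ncard : ℝ) + 1 ≤ W.card := by exact_mod_cast Nat.lt_two_pow_self.trans_le hpow
    have h3 : (Z.ncard : ℝ) / ((W.card : ℝ) - 1) ≤ 1 := by
      rw [div_le_one (by linarith)]
      linarith
    have h4 : 0 ≤ (Y.ncard : ℝ) / ((Nat.card (P.Gp Y) : ℝ) - 1) :=
      div_nonneg (by positivity) (by linarith)
    linarith

theorem IsMinimal.Psi_eq_max [Nontrivial G] (hP : P.IsMinimal) {Y : Set X}
    (hY : P.IsExtremalFinite Y) : P.Psi = max P.Xi (P.induced Y).Psi := by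
  have := hY.finite
  refine le_antisymm ?_ (max_le P.Xi_le_Psi (hP.Psi_induced_le Y))
  rcases P.Xi_le_Psi.eq_or_lt with h | h
  · exact h ▸ le_max_left _ _
  · exact (hP.Psi_le_induced hY h).trans (le_max_right _ _)

/-! ### The extreme values Ψ = n − 1 and Ψ = 0 for infinite and for free groups -/

theorem isAmenable_of_card_eq_one [Infinite G] (P : GroupPresentation X G)
    (h : Nat.card X = 1) : IsAmenableGroup G := by
  classical
  obtain ⟨hsub, ⟨x⟩⟩ := Nat.card_eq_one_iff_unique.1 h
  have hord : ¬ IsOfFinOrder (P.gen x) := by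
    intro hfin
    have htop := P.eq_top_of_gen_mem (K := Subgroup.zpowers (P.gen x)) fun y => by
      rw [Subsingleton.elim y x]
      exact Subgroup.mem_zpowers _
    have := hfin.finite_zpowers
    rw [htop, Subgroup.coe_top, Set.finite_univ_iff] at this
    exact not_finite G
  have hinj := injective_pow_iff_not_isOfFinOrder.2 hord
  refine P.amenable_of_folner fun ε hε => ?_
  obtain ⟨k, hk⟩ := exists_nat_gt (1 / ε)
  have hkpos : 0 < k := by
    have : (0 : ℝ) < k := lt_trans (by positivity) hk
    exact_mod_cast this
  have hcard : ((Finset.range k).image fun i => P.gen x ^ i).card = k := by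
    rw [Finset.card_image_of_injective _ hinj, Finset.card_range]
  -- In an infinite cyclic group k consecutive powers span at least k − 1 edges; the deficit 1 is
  -- less than εk.
  refine ⟨(Finset.range k).image fun i => P.gen x ^ i, Finset.card_pos.1 (by omega), ?_⟩
  have hE : k - 1 ≤ (P.inducedEdges ((Finset.range k).image fun i => P.gen x ^ i)).card := by
    rw [← Finset.card_range (k - 1)]
    refine Finset.card_le_card_of_injOn (fun i => (P.gen x ^ i, x)) ?_
      fun i _ j _ hij => hinj (Prod.mk.inj hij).1
    intro i hi
    rw [Finset.coe_range, Set.mem_Iio] at hi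
    refine mem_inducedEdges.2 ⟨Finset.mem_image_of_mem _ (Finset.mem_range.2 (by omega)), ?_⟩
    rw [← pow_succ]
    exact Finset.mem_image_of_mem (fun i => P.gen x ^ i) (Finset.mem_range.2 (by omega))
  have hE' : (k : ℝ) ≤
      (P.inducedEdges ((Finset.range k).image fun i => P.gen x ^ i)).card + 1 := by
    exact_mod_cast Nat.sub_le_iff_le_add.1 hE
  rw [hcard, h, Nat.cast_one, one_mul]
  rw [div_lt_iff₀ hε] at hk
  linarith

/-- Outside the exceptional cases, `Psi` is bounded away from `n - 1`. -/
theorem IsMinimal.isAmenable_or_of_Psi_eq [Infinite G] (hP : P.IsMinimal)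
    (h : P.Psi = (((Nat.card X : ℝ) - 1 : ℝ) : EReal)) :
    IsAmenableGroup G ∨ (Nat.card X = 2 ∧ ∃ x : X, orderOf (P.gen x) = 2) := by
  classical
  by_contra! hcon
  obtain ⟨hna, hex⟩ := hcon
  have hn : (1 : ℝ) ≤ Nat.card X := by exact_mod_cast P.card_pos_of_nontrivial
  obtain ⟨ε, hε, hS⟩ : ∃ ε : ℝ, 0 < ε ∧ ∀ S : Finset G, S.Nonempty →
      ε * S.card ≤ (Nat.card X : ℝ) * S.card - (P.inducedEdges S).card := by
    by_contra! h
    exact hna (P.amenable_of_folner h)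
  have hstrict : ∀ S : Finset G, 2 ≤ S.card →
      ((P.inducedEdges S).card : ℝ) + Nat.card X + 1 ≤ Nat.card X * S.card := by
    intro S hS2
    have h1 := hP.card_inducedEdges_add_le (Finset.card_pos.1 (by omega : 0 < S.card))
      (coe_finset_ne_univ S)
    have h2 : (P.inducedEdges S).card + Nat.card X ≠ Nat.card X * S.card := fun h => by
      rcases hP.eq_one_or_eq_two hS2 h with h | ⟨h, x, hx⟩
      · exact hna (isAmenable_of_card_eq_one P h)
      · exact hex h x hx
    exact_mod_cast lt_of_le_of_ne h1 h2
  have hn2 : (2 : ℝ) ≤ Nat.card X := by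
    have h1 : Nat.card X ≠ 1 := fun h => hna (isAmenable_of_card_eq_one P h)
    have h2 := P.card_pos_of_nontrivial
    exact_mod_cast (by omega : 2 ≤ Nat.card X)
  -- The boundary b satisfies b ≥ n + 1 and b ≥ ε|S| ≥ (n + 1)δ|S|. Adding n times the first to the
  -- second gives b ≥ n + δ|S|, hence Ψ ≤ n − 1 − δ; δ ≤ 1 keeps this bound non-negative.
  obtain ⟨δ, hδ, hδ1, hδε⟩ : ∃ δ : ℝ, 0 < δ ∧ δ ≤ 1 ∧ δ * (Nat.card X + 1) ≤ ε := by
    refine ⟨min 1 (ε / (Nat.card X + 1)), by positivity, min_le_left _ _, ?_⟩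
    rw [← le_div_iff₀ (by positivity)]
    exact min_le_right _ _
  have hΨ := P.Psi_le (q := (Nat.card X : ℝ) - 1 - δ) (by linarith) fun S hSne => by
    rcases (Nat.one_le_iff_ne_zero.2 (Finset.card_pos.2 hSne).ne').eq_or_lt with h1 | h1
    · rw [hP.card_inducedEdges_singleton h1.symm, ← h1]
      simp
    · have h2 := hstrict S h1
      have h3 := hS S hSne
      have h4 : (0 : ℝ) ≤ S.card := by positivity
      have h5 := mul_le_mul_of_nonneg_right hδε h4
      have h6 : ((Nat.card X : ℝ) + 1) * (Nat.card X + δ * S.card) ≤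
          (Nat.card X + 1) * (Nat.card X * S.card - (P.inducedEdges S).card) := by
        nlinarith
      have h7 := le_of_mul_le_mul_left h6 (by linarith)
      linarith
  rw [h, EReal.coe_le_coe_iff] at hΨ
  linarith

/-- If ψ < n − 1, a Følner set for ε = n − 1 − ψ has more than (1 + ψ)|S| edges, which is too many.
In the other case the double edge of an involution gives ψ ≥ 1 = n − 1. -/
theorem IsMinimal.Psi_eq_of_isAmenable_or [Infinite G] (hP : P.IsMinimal)
    (h : IsAmenableGroup G ∨ (Nat.card X = 2 ∧ ∃ x : X, orderOf (P.gen x) = 2)) :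
    P.Psi = (((Nat.card X : ℝ) - 1 : ℝ) : EReal) := by
  classical
  obtain ⟨ψ, hψ0, hψ⟩ := hP.exists_Psi_eq
  have hub := hP.Psi_le_of_infinite
  refine le_antisymm hub ?_
  have hle := fun S (hS : S.Nonempty) => hP.card_inducedEdges_le_of_Psi_le (S := S) hψ.le hS
  rw [hψ, EReal.coe_le_coe_iff] at hub ⊢
  rcases h with h | ⟨h, x, hx⟩
  · by_contra! hlt
    obtain ⟨S, hS, hSE⟩ := P.exists_folner_of_amenable h (sub_pos.2 hlt)
    have h1 := hle S hS
    linarith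
  · have h1 := hle {1, P.gen x} ⟨1, by simp⟩
    have h2 : ({1, P.gen x} : Finset G).card = 2 := Finset.card_pair (hP.gen_ne_one x).symm
    have h3 : 2 ≤ (P.inducedEdges {1, P.gen x}).card := by
      have h4 : ({(1, x), (P.gen x, x)} : Finset (G × X)).card = 2 :=
        Finset.card_pair fun h => hP.gen_ne_one x (Prod.mk.inj h).1.symm
      rw [← h4]
      refine Finset.card_le_card fun e he => ?_
      have h5 : P.gen x * P.gen x = 1 := by rw [← sq, ← hx, pow_orderOf_eq_one]
      rw [Finset.mem_insert, Finset.mem_singleton] at he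
      rcases he with rfl | rfl <;> simp [mem_inducedEdges, h5]
    have h6 : (2 : ℝ) ≤ (P.inducedEdges {1, P.gen x}).card := by exact_mod_cast h3
    rw [h2] at h1
    push_cast at h1
    rw [h]
    push_cast
    linarith

/-- Ψ = 0 says that every full subgraph on a set S has at most |S| − 1 edges, which characterizes
free bases. -/
theorem IsMinimal.Psi_eq_zero_iff [Nontrivial G] (hP : P.IsMinimal) {n : ℕ}
    (hn : Nat.card X = n) : P.Psi = 0 ↔ Nonempty (G ≃* FreeGroup (Fin n)) := by
  constructor
  · intro h
    have hinj := P.injective_lift_of_card_inducedEdges_lt fun S hS => by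
      have h1 := hP.card_inducedEdges_le_of_Psi_le (q := 0) (by rw [h]; rfl) hS
      rw [add_zero, one_mul, le_sub_iff_add_le] at h1
      exact_mod_cast h1
    exact ⟨(MulEquiv.ofBijective _ ⟨hinj, P.surjective_lift⟩).symm.trans
      (FreeGroup.freeGroupCongr (Finite.equivFinOfCardEq hn))⟩
  · rintro ⟨e⟩
    refine le_antisymm ?_ P.Psi_nonneg
    refine P.Psi_le le_rfl fun S hS => ?_
    have h1 := P.card_inducedEdges_lt_of_injective_lift (P.injective_lift_of_freeGroup hn e) hS
    rw [add_zero, one_mul, le_sub_iff_add_le]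
    exact_mod_cast h1

end GroupPresentation

end

/-! ### The theorem -/

theorem theorem5p2 {X : Type u} [Finite X] {G : Type v} [Group G] [Nontrivial G]
    (P : GroupPresentation X G) (hP : P.IsMinimal) (n : ℕ) (hn : Nat.card X = n) :
    (((1 - (n : ℝ) : ℝ) : EReal) ≤ P.PsiHat ∧ P.PsiHat ≤ 1) ∧
    (Finite G →
      P.PsiHat = (((n : ℝ) / ((Nat.card G : ℝ) - 1) : ℝ) : EReal) ∧
      (P.PsiHat = 1 ↔ Nat.card G = 2)) ∧
    (Infinite G →
      P.PsiHat ≤ 0 ∧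
      (P.PsiHat = 0 ↔ IsAmenableGroup G ∨ (n = 2 ∧ ∃ x : X, orderOf (P.gen x) = 2)) ∧
      (P.PsiHat = ((1 - (n : ℝ) : ℝ) : EReal) ↔ Nonempty (G ≃* FreeGroup (Fin n)))) ∧
    (∀ Y : Set X, P.IsExtremalFinite Y →
      P.Psi = max P.Xi (P.induced Y).Psi ∧
      (Nontrivial (P.Gp Y) →
        (P.induced Y).Psi = ((((Y.ncard : ℝ) - 1) +
            (Y.ncard : ℝ) / ((Nat.card (P.Gp Y) : ℝ) - 1) : ℝ) : EReal))) := by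
  subst hn
  obtain ⟨ψ, hψ0, hψ⟩ := hP.exists_Psi_eq
  have hhat : P.PsiHat = ((1 - (Nat.card X : ℝ) + ψ : ℝ) : EReal) := by
    rw [GroupPresentation.PsiHat, hψ, ← EReal.coe_add]
  have hone : (1 : EReal) = ((1 : ℝ) : EReal) := rfl
  have hzero : (0 : EReal) = ((0 : ℝ) : EReal) := rfl
  have hnpos : (1 : ℝ) ≤ Nat.card X := by exact_mod_cast P.card_pos_of_nontrivial
  have hfin : Finite G → 1 - (Nat.card X : ℝ) + ψ = (Nat.card X : ℝ) / ((Nat.card G : ℝ) - 1) ∧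
      (Nat.card X : ℝ) + 1 ≤ Nat.card G := by
    intro hG
    have h1 := hP.Psi_eq_of_finite
    rw [hψ, EReal.coe_eq_coe_iff] at h1
    exact ⟨by rw [h1]; ring, by exact_mod_cast Nat.lt_two_pow_self.trans_le hP.two_pow_le_card⟩
  have hinf : Infinite G → ψ ≤ (Nat.card X : ℝ) - 1 := by
    intro hG
    have h1 := hP.Psi_le_of_infinite
    rwa [hψ, EReal.coe_le_coe_iff] at h1
  refine ⟨⟨?_, ?_⟩, fun hG => ⟨?_, ?_⟩, fun hG => ⟨?_, ?_, ?_⟩, fun Y hY =>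
    ⟨hP.Psi_eq_max hY, fun hnt => ?_⟩⟩
  · rw [hhat, EReal.coe_le_coe_iff]
    linarith
  · rw [hhat, hone, EReal.coe_le_coe_iff]
    rcases finite_or_infinite G with hG | hG
    · obtain ⟨h1, h2⟩ := hfin hG
      rw [h1, div_le_one (by linarith)]
      linarith
    · linarith [hinf hG]
  · rw [hhat, (hfin hG).1]
  · obtain ⟨h1, h2⟩ := hfin hG
    rw [hhat, h1, hone, EReal.coe_eq_coe_iff, div_eq_one_iff_eq (by linarith)]
    have h3 := hP.two_pow_le_card
    have h4 := P.card_pos_of_nontrivial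
    constructor
    · intro h
      have h5 : Nat.card X + 1 = Nat.card G := by
        have : (Nat.card X : ℝ) + 1 = Nat.card G := by linarith
        exact_mod_cast this
      -- The value 1 means |G| = n + 1, whereas |G| ≥ 2^n; hence n = 1.
      have h6 : ∀ k : ℕ, 2 ≤ k → k + 1 < 2 ^ k := fun k hk => by
        induction k, hk using Nat.le_induction with
        | base => norm_num
        | succ k hk ih =>
          rw [pow_succ]
          omega
      by_contra hne
      have := h6 (Nat.card X) (by omega)
      omega
    · intro h
      have h5 : (Nat.card G : ℝ) = 2 := by exact_mod_cast h
      linarith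
  · rw [hhat, hzero, EReal.coe_le_coe_iff]
    linarith [hinf hG]
  · have hiff : P.PsiHat = 0 ↔ P.Psi = (((Nat.card X : ℝ) - 1 : ℝ) : EReal) := by
      rw [hhat, hψ, hzero, EReal.coe_eq_coe_iff, EReal.coe_eq_coe_iff]
      constructor <;> intro h <;> linarith
    rw [hiff]
    exact ⟨hP.isAmenable_or_of_Psi_eq, hP.Psi_eq_of_isAmenable_or⟩
  · rw [← hP.Psi_eq_zero_iff rfl, hhat, hψ, hzero, EReal.coe_eq_coe_iff, EReal.coe_eq_coe_iff]
    constructor <;> intro h <;> linarith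
  · have := hY.finite
    exact hP.Psi_induced_eq Y
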